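/- For integers $m\ge 0$ let $V_m(x)=\frac1{m!}\int_0^\infty \frac{u^m e^{-u}}{\sqrt{x^2+u}}\,du$ be the Coulomb potential regularized by the lowest-band Landau state of angular momentum $-m$, and put $V_{-1}(x)=1/|x|$. For $Z>0$, $M>0$ and measurable real functions $V_j$ ($1\le j\le N$) and $W_{jk}$ ($1\le j<k\le N$) on $\mathbb R$, let $$h(N,Z,M)=\sum_{j=1}^N\Big[-\frac1M\frac{d^2}{dx_j^2}-Z\,V_j(x_j)\Big]+\sum_{j<k}W_{jk}(x_j-x_k)$$ on $L^2(\mathbb R^N)$, let $E_0(N)\in(-\infty,\infty]$ be the infimum of $\langle\Phi,h\Phi\rangle$ over normalized $\Phi\in H^1(\mathbb R^N)$ with finite potential energy, and let $E_0^{(k)}(N-1)$ be the corresponding infimum for the $(N-1)$-particle Hamiltonian obtained from $h$ by omitting all terms that involve $x_k$. We say that $h$ has a bound state if $E_0(N)<\min_k E_0^{(k)}(N-1)$. We say that the potential bounds hold with $\mu,\nu$ if $$V_j(x)\le V_\mu(x)\qquad\text{and}\qquad W_{jk}(x)\ge \tfrac1{\sqrt2}\,V_{\nu-1}\big(\tfrac{x}{\sqrt2}\big)$$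 for all $j$, all $j<k$ and all $x$ (with $x\neq0$ in the second bound if $\nu=0$). Corollary 3. Let $a>0$, $p>3$ and $Z_0>1$. There is a constant $A>0$, depending only on $a$, $p$ and $Z_0$, such that the following holds for all real $Z\ge Z_0$ and $B=aZ^p$. (i) If the potential bounds hold with integers $0\le\nu\le2\mu$, and $N>3Z+A\,Z(\log Z)^2$, then the Hamiltonian $h(N,Z,B^{-1/2})$ has no bound state. (ii) Suppose that potentials are given for every $N$ (possibly depending on $N$) and that for every $N$ the potential bounds hold with some integers $0\le\nu_N\le2\mu_N$. Let $N_{\max}(Z,B)$ be the largest $N$ for which $h(N,Z,B^{-1/2})$ has a bound state. Then $N_{\max}(Z,B)$ is finite and $N_{\max}(Z,B)\le 3Z+A\,Z(\log Z)^2$. -/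

import Mathlib

open MeasureTheory Filter Topology
open scoped ContDiff

noncomputable section

namespace StrongField

/-- The Coulomb potential regularized by the Landau state of angular momentum `-m` (field strength
one): `V_m(x) = (1 / m!) ∫₀^∞ u^m e^{-u} / √(x² + u) du`, which is the expectation of `1 / |r|` in
the normalized state with density `|ζ|^{2m} e^{-|ζ|²} / (π m!)`. -/
def regCoulomb (m : ℕ) (x : ℝ) : ℝ :=
  (1 / (m.factorial : ℝ)) * ∫ u in Set.Ioi (0 : ℝ), u ^ m * Real.exp (-u) / √(x ^ 2 + u)

/-- `V_{ν-1}` for `ν ≥ 0`. For `ν = 0` the symbol `V_{-1}` has its limiting meaning `1 / |x|`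
(the probability density `u^m e^{-u} / Γ(m+1)` concentrates at `u = 0` as `m → -1`). -/
def regCoulombPred : ℕ → ℝ → ℝ
  | 0, x => 1 / |x|
  | m + 1, x => regCoulomb m x

section System

variable {ι : Type*} [Fintype ι] [LinearOrder ι]

/-- `Φ` belongs to the Sobolev space `H¹(ℝ^ι)` and has the weak partial derivatives `g i`:
`(Φ, g)` is an `L²` limit of smooth compactly supported functions and their partial derivatives. -/
def HasSobolevGradient (Φ : (ι → ℝ) → ℂ) (g : ι → (ι → ℝ) → ℂ) : Prop :=
  MemLp Φ 2 volume ∧ (∀ i, MemLp (g i) 2 volume) ∧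
    ∃ φ : ℕ → (ι → ℝ) → ℂ,
      (∀ n, ContDiff ℝ ∞ (φ n) ∧ HasCompactSupport (φ n)) ∧
      Tendsto (fun n => eLpNorm (fun x => φ n x - Φ x) 2 volume) atTop (𝓝 0) ∧
      ∀ i, Tendsto
        (fun n => eLpNorm (fun x => fderiv ℝ (φ n) x (Pi.single i 1) - g i x) 2 volume)
        atTop (𝓝 0)

/-- The total potential `- Z ∑_j V_j(x_j) + ∑_{j<k} W_{jk}(x_j - x_k)`. -/
def totalPotential (Z : ℝ) (V : ι → ℝ → ℝ) (W : ι → ι → ℝ → ℝ) (x : ι → ℝ) : ℝ :=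
  -Z * ∑ j, V j (x j) + ∑ j, ∑ k with j < k, W j k (x j - x k)

/-- The values `⟨Φ, h Φ⟩` on normalized `Φ` of the form domain (`Φ ∈ H¹` with finite potential
energy) of
`h = ∑_j [-(1/M) d²/dx_j² - Z V_j(x_j)] + ∑_{j<k} W_{jk}(x_j - x_k)`. -/
def energyValues (Z M : ℝ) (V : ι → ℝ → ℝ) (W : ι → ι → ℝ → ℝ) : Set ℝ :=
  {e | ∃ (Φ : (ι → ℝ) → ℂ) (g : ι → (ι → ℝ) → ℂ),
    HasSobolevGradient Φ g ∧
    Integrable (fun x => totalPotential Z V W x * ‖Φ x‖ ^ 2) volume ∧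
    ∫ x, ‖Φ x‖ ^ 2 = 1 ∧
    e = 1 / M * (∑ i, (∫ x, ‖g i x‖ ^ 2)) + (∫ x, totalPotential Z V W x * ‖Φ x‖ ^ 2)}

/-- The ground state energy `inf_{‖Φ‖ = 1} ⟨Φ, h Φ⟩`. -/
def groundEnergy (Z M : ℝ) (V : ι → ℝ → ℝ) (W : ι → ι → ℝ → ℝ) : EReal :=
  ⨅ e ∈ energyValues Z M V W, (e : EReal)

/-- The ground state energy of the system from which particle `k` has been removed: all the terms
of the Hamiltonian that involve `x_k` are omitted, the other potentials are kept. -/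
def groundEnergyRemove (Z M : ℝ) (V : ι → ℝ → ℝ) (W : ι → ι → ℝ → ℝ) (k : ι) : EReal :=
  groundEnergy (ι := {j : ι // j ≠ k}) Z M (fun j => V j) (fun i j => W i j)

/-- The Hamiltonian has a bound state: its ground state energy lies strictly below that of every
system with one particle less. -/
def HasBoundState (Z M : ℝ) (V : ι → ℝ → ℝ) (W : ι → ι → ℝ → ℝ) : Prop :=
  groundEnergy Z M V W < ⨅ k, groundEnergyRemove Z M V W k

/-- The bounds `V_j(x) ≤ V_μ(x)` and `W_{jk}(x) ≥ (1/√2) V_{ν-1}(x/√2)` on (measurable)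
effective potentials. -/
def PotentialBounds (μ ν : ℕ) (V : ι → ℝ → ℝ) (W : ι → ι → ℝ → ℝ) : Prop :=
  (∀ j, Measurable (V j)) ∧ (∀ j k, j < k → Measurable (W j k)) ∧
  (∀ j x, V j x ≤ regCoulomb μ x) ∧
  (∀ j k, j < k → ∀ x, 1 / √2 * regCoulombPred ν (x / √2) ≤ W j k x)

end System

/-- For a model that prescribes effective potentials for each number `N` of electrons: the largest
`N` for which the `N`-electron Hamiltonian has a bound state (`⊤` if there are arbitrarily large
such `N`). -/
def maxElectrons (Z M : ℝ) (V : (N : ℕ) → Fin N → ℝ → ℝ)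
    (W : (N : ℕ) → Fin N → Fin N → ℝ → ℝ) : ℕ∞ :=
  ⨆ N ∈ {N : ℕ | HasBoundState Z M (V N) (W N)}, (N : ℕ∞)

end StrongField

end

namespace StrongField

/-! The proof is a Benguria–Lieb argument: the equation of a bound state is tested, for each
electron, against a weight growing like the inverse of the potential. With `s = μ + 1`, the
potential bounds reduce to attraction at most `3 / √(x² + s)` and, off the origin, repulsion at
least `1 / √(x² + 4s)` (`PotentialBounds.coulombBounds`). The weight is `φ = √(x² + s)`, cut off to
`w = φ / (1 + εφ)`.

Weighted attraction is at most `3Z` per electron. Weighted repulsion of a pair, symmetrized, is at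
least `1` up to the cutoff, because `√((x - y)² + 4s) ≤ φ(x) + φ(y)` (`one_sub_weight_le`). Summing
over electrons compares `N(N - 1)/2` with `N` times the attraction and the localization error. The
cutoff error is absorbed by the binding gap, which is where the bound state enters.

No minimizer is needed. An almost minimizing `Φ` is compared with `√(1 - t w(x_k)) Φ`, and the first
order in `t` plays the role of the Euler–Lagrange equation (`weighted_energy_le`). The terms without
`x_k` are bounded below by the energy of the remaining particles on almost every slice of fixed
`x_k` (`CoulombBounds.weighted_lower_bound`).

The localization error is `1/(4M)` times the expectation of `1 / √(x_k² + 1)`. This function is, up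
to `1/L`, the derivative of a function bounded by `log L`, so integration by parts bounds its
expectation by the kinetic energy in `x_k`. That kinetic energy is in turn bounded by the
attraction, hence by the same expectation; closing the loop gives `12 Z M (log L)² + 2/L`
(`CoulombBounds.integral_inv_sqrt_le`). The outcome is `N ≤ 3 + 2D` with `D = 3Z + 3Z (log L)² +
1/(2LM)`. For `L = Z^(p/2)` the last term is constant, and since `log Z ≥ log Z₀ > 0` everything
beyond `3Z` fits into `A Z (log Z)²`. -/

/-! ### Two-sided bounds for the regularized Coulomb potentials -/

theorem integrableOn_pow_mul_exp_neg (m : ℕ) :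
    IntegrableOn (fun u : ℝ => u ^ m * Real.exp (-u)) (Set.Ioi 0) := by
  have h := Real.GammaIntegral_convergent (s := m + 1) (by positivity)
  refine h.congr_fun (fun u _ => ?_) measurableSet_Ioi
  simp [mul_comm]

theorem integral_pow_mul_exp_neg (m : ℕ) :
    ∫ u in Set.Ioi (0 : ℝ), u ^ m * Real.exp (-u) = m.factorial := by
  rw [← Real.Gamma_nat_eq_factorial, Real.Gamma_eq_integral (by positivity)]
  refine setIntegral_congr_fun measurableSet_Ioi (fun u _ => ?_)
  simp [mul_comm]

theorem pow_mul_exp_neg_div_sqrt_eq (m : ℕ) {u : ℝ} (hu : 0 < u) :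
    u ^ m * Real.exp (-u) / √u = Real.exp (-u) * u ^ (((m : ℝ) + 1 / 2) - 1) := by
  rw [show ((m : ℝ) + 1 / 2) - 1 = m - 1 / 2 by ring, Real.rpow_sub hu, Real.rpow_natCast,
    Real.sqrt_eq_rpow]
  ring

theorem integrableOn_pow_mul_exp_neg_div_sqrt (m : ℕ) :
    IntegrableOn (fun u : ℝ => u ^ m * Real.exp (-u) / √u) (Set.Ioi 0) :=
  (Real.GammaIntegral_convergent (s := m + 1 / 2) (by positivity)).congr_fun
    (fun _ hu => (pow_mul_exp_neg_div_sqrt_eq m hu).symm) measurableSet_Ioi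

theorem integral_pow_mul_exp_neg_div_sqrt (m : ℕ) :
    ∫ u in Set.Ioi (0 : ℝ), u ^ m * Real.exp (-u) / √u = Real.Gamma (m + 1 / 2) := by
  rw [Real.Gamma_eq_integral (by positivity)]
  exact setIntegral_congr_fun measurableSet_Ioi (fun _ hu => pow_mul_exp_neg_div_sqrt_eq m hu)

/-- Induction on the squared inequality: the base case is `π ≤ 4`, and the step is `(m + 2)(m +
1/2)² ≤ (m + 1)³`. It bounds the mean of `1/√u` under the Gamma density by `2/√(m + 1)`. -/
theorem sqrt_mul_Gamma_add_half_le (m : ℕ) :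
    √((m : ℝ) + 1) * Real.Gamma (m + 1 / 2) ≤ 2 * m.factorial := by
  have key : ((m : ℝ) + 1) * Real.Gamma (m + 1 / 2) ^ 2 ≤ 4 * (m.factorial : ℝ) ^ 2 := by
    induction m with
    | zero =>
      have h := Real.Gamma_one_half_eq
      simp only [Nat.cast_zero, zero_add, h, Real.sq_sqrt Real.pi_pos.le]
      simpa using Real.pi_le_four
    | succ m ih =>
      have h : Real.Gamma (((m + 1 : ℕ) : ℝ) + 1 / 2)
          = ((m : ℝ) + 1 / 2) * Real.Gamma (m + 1 / 2) := by
        rw [← Real.Gamma_add_one (by positivity)]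
        push_cast
        ring_nf
      rw [h, Nat.factorial_succ]
      push_cast
      set G := Real.Gamma ((m : ℝ) + 1 / 2)
      have hm : (0 : ℝ) ≤ m := Nat.cast_nonneg m
      have h1 : ((m : ℝ) + 1 + 1) * (m + 1 / 2) ^ 2 ≤ (m + 1) ^ 3 := by nlinarith [sq_nonneg (m : ℝ)]
      calc ((m : ℝ) + 1 + 1) * ((m + 1 / 2) * G) ^ 2
          = (((m : ℝ) + 1 + 1) * (m + 1 / 2) ^ 2) * G ^ 2 := by ring
        _ ≤ (m + 1) ^ 3 * G ^ 2 := by gcongr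
        _ = (m + 1) ^ 2 * ((m + 1) * G ^ 2) := by ring
        _ ≤ (m + 1) ^ 2 * (4 * (m.factorial : ℝ) ^ 2) := by gcongr
        _ = _ := by ring
  refine abs_le_of_sq_le_sq' ?_ (by positivity) |>.2
  rw [mul_pow, Real.sq_sqrt (by positivity)]
  linarith

theorem pow_mul_exp_neg_div_sqrt_add_le (m : ℕ) (x : ℝ) {u : ℝ} (hu : 0 < u) :
    u ^ m * Real.exp (-u) / √(x ^ 2 + u) ≤ u ^ m * Real.exp (-u) / √u := by
  gcongr
  nlinarith [sq_nonneg x]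

theorem integrableOn_regCoulomb (m : ℕ) (x : ℝ) :
    IntegrableOn (fun u : ℝ => u ^ m * Real.exp (-u) / √(x ^ 2 + u)) (Set.Ioi 0) := by
  refine (integrableOn_pow_mul_exp_neg_div_sqrt m).mono' ?_ ?_
  · exact Measurable.aestronglyMeasurable (by fun_prop)
  · filter_upwards [ae_restrict_mem measurableSet_Ioi] with u hu
    have hu : 0 < u := hu
    rw [Real.norm_of_nonneg (by positivity)]
    exact pow_mul_exp_neg_div_sqrt_add_le m x hu

/-- With `q = √(x² + m + 1)`, the integrand obeys `1/√(x² + u) ≤ (1 + √(m + 1)/√u) / q`. Averaging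
over the Gamma density gives at most `1 + 2 = 3` in the numerator. -/
theorem regCoulomb_le (m : ℕ) (x : ℝ) : regCoulomb m x ≤ 3 / √(x ^ 2 + (m + 1)) := by
  have hq : 0 < √(x ^ 2 + ((m : ℝ) + 1)) := by positivity
  have hI : ∫ u in Set.Ioi (0 : ℝ), u ^ m * Real.exp (-u) / √(x ^ 2 + u) ≤
      ∫ u in Set.Ioi (0 : ℝ), (√(x ^ 2 + ((m : ℝ) + 1)))⁻¹ * (u ^ m * Real.exp (-u) +
        √((m : ℝ) + 1) * (u ^ m * Real.exp (-u) / √u)) := by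
    refine setIntegral_mono_on (integrableOn_regCoulomb m x) ?_ measurableSet_Ioi fun u hu => ?_
    · exact (Integrable.add (integrableOn_pow_mul_exp_neg m)
        ((integrableOn_pow_mul_exp_neg_div_sqrt m).const_mul _)).const_mul _
    · have hu : 0 < u := hu
      have hr : 0 < √(x ^ 2 + u) := by positivity
      have hs : 0 < √u := by positivity
      have h1 : √(x ^ 2 + ((m : ℝ) + 1)) * √u ≤ √(x ^ 2 + u) * (√u + √((m : ℝ) + 1)) := by
        refine abs_le_of_sq_le_sq' ?_ (by positivity) |>.2
        rw [mul_pow, mul_pow, Real.sq_sqrt (by positivity), Real.sq_sqrt hu.le,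
          Real.sq_sqrt (by positivity), add_sq, Real.sq_sqrt hu.le, Real.sq_sqrt (by positivity)]
        have h3 : 0 ≤ (x ^ 2 + u) * (2 * √u * √((m : ℝ) + 1)) := by positivity
        have h4 : 0 ≤ x ^ 2 * ((m : ℝ) + 1) := by positivity
        nlinarith
      have h2 : 1 / √(x ^ 2 + u) ≤ (√(x ^ 2 + ((m : ℝ) + 1)))⁻¹ * (1 + √((m : ℝ) + 1) / √u) := by
        rw [inv_mul_eq_div, div_le_div_iff₀ hr hq]
        have : (1 + √((m : ℝ) + 1) / √u) * √(x ^ 2 + u)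
            = (√(x ^ 2 + u) * (√u + √((m : ℝ) + 1))) / √u := by
          field_simp
        rw [this, le_div_iff₀ hs]
        linarith
      calc u ^ m * Real.exp (-u) / √(x ^ 2 + u)
          = u ^ m * Real.exp (-u) * (1 / √(x ^ 2 + u)) := by ring
        _ ≤ u ^ m * Real.exp (-u) *
            ((√(x ^ 2 + ((m : ℝ) + 1)))⁻¹ * (1 + √((m : ℝ) + 1) / √u)) := by gcongr
        _ = _ := by ring
  rw [integral_const_mul, integral_add (integrableOn_pow_mul_exp_neg m)
    ((integrableOn_pow_mul_exp_neg_div_sqrt m).const_mul _), integral_const_mul,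
    integral_pow_mul_exp_neg, integral_pow_mul_exp_neg_div_sqrt] at hI
  have hf : (0 : ℝ) < m.factorial := by positivity
  calc regCoulomb m x
      ≤ 1 / (m.factorial : ℝ) * ((√(x ^ 2 + ((m : ℝ) + 1)))⁻¹ *
        (m.factorial + √((m : ℝ) + 1) * Real.Gamma (m + 1 / 2))) := by
        unfold regCoulomb
        gcongr
    _ ≤ 1 / (m.factorial : ℝ) * ((√(x ^ 2 + ((m : ℝ) + 1)))⁻¹ *
        (m.factorial + 2 * m.factorial)) := by
        refine mul_le_mul_of_nonneg_left (mul_le_mul_of_nonneg_left ?_ (by positivity))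
          (by positivity)
        linarith [sqrt_mul_Gamma_add_half_le m]
    _ = _ := by
        field_simp
        ring

/-- The tangent line of `r ↦ 1 / √r` lies below the graph. -/
theorem inv_sqrt_tangent_le {q r : ℝ} (hq : 0 < q) (hr : 0 < r) :
    3 / 2 * (1 / q) - 1 / (2 * q ^ 3) * r ^ 2 ≤ 1 / r := by
  have h : 1 / r - (3 / 2 * (1 / q) - 1 / (2 * q ^ 3) * r ^ 2)
      = (r - q) ^ 2 * (r + 2 * q) / (2 * q ^ 3 * r) := by
    field_simp
    ring
  have : 0 ≤ (r - q) ^ 2 * (r + 2 * q) / (2 * q ^ 3 * r) := by positivity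
  linarith

/-- Jensen's inequality: `u ↦ 1/√(x² + u)` is convex and the density `u^m e^{-u}/m!` has mean `m +
1`. It is carried out by integrating the tangent line at the mean. -/
theorem le_regCoulomb (m : ℕ) (x : ℝ) : 1 / √(x ^ 2 + (m + 1)) ≤ regCoulomb m x := by
  set q := √(x ^ 2 + ((m : ℝ) + 1)) with hqd
  have hq : 0 < q := by positivity
  have hq2 : q ^ 2 = x ^ 2 + (m + 1) := Real.sq_sqrt (by positivity)
  have hI : ∫ u in Set.Ioi (0 : ℝ), ((3 / 2 * (1 / q) - 1 / (2 * q ^ 3) * x ^ 2) *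
        (u ^ m * Real.exp (-u)) - 1 / (2 * q ^ 3) * (u ^ (m + 1) * Real.exp (-u))) ≤
      ∫ u in Set.Ioi (0 : ℝ), u ^ m * Real.exp (-u) / √(x ^ 2 + u) := by
    refine setIntegral_mono_on ?_ (integrableOn_regCoulomb m x) measurableSet_Ioi fun u hu => ?_
    · exact Integrable.sub ((integrableOn_pow_mul_exp_neg m).const_mul _)
        ((integrableOn_pow_mul_exp_neg (m + 1)).const_mul _)
    · have hu : 0 < u := hu
      have hr : 0 < √(x ^ 2 + u) := by positivity
      have h := inv_sqrt_tangent_le hq hr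
      rw [Real.sq_sqrt (by positivity)] at h
      calc _ = u ^ m * Real.exp (-u) * (3 / 2 * (1 / q) - 1 / (2 * q ^ 3) * (x ^ 2 + u)) := by
            ring
        _ ≤ u ^ m * Real.exp (-u) * (1 / √(x ^ 2 + u)) := by gcongr
        _ = _ := by ring
  rw [integral_sub ((integrableOn_pow_mul_exp_neg m).const_mul _)
        ((integrableOn_pow_mul_exp_neg (m + 1)).const_mul _), integral_const_mul,
    integral_const_mul, integral_pow_mul_exp_neg, integral_pow_mul_exp_neg,
    Nat.factorial_succ] at hI
  push_cast at hI
  have hf : (0 : ℝ) < m.factorial := by positivity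
  have h1 : (3 / 2 * (1 / q) - 1 / (2 * q ^ 3) * x ^ 2) * (m.factorial : ℝ)
      - 1 / (2 * q ^ 3) * ((m + 1) * m.factorial) = 1 / q * m.factorial := by
    have : (3 / 2 * (1 / q) - 1 / (2 * q ^ 3) * x ^ 2) * (m.factorial : ℝ)
      - 1 / (2 * q ^ 3) * ((m + 1) * m.factorial)
      = (3 / 2 * (1 / q) - 1 / (2 * q ^ 3) * (x ^ 2 + (m + 1))) * m.factorial := by ring
    rw [this, ← hq2]
    field_simp
    ring
  rw [h1] at hI
  calc 1 / q = 1 / (m.factorial : ℝ) * (1 / q * m.factorial) := by field_simp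
    _ ≤ _ := by
      unfold regCoulomb
      gcongr

/-- For `ν = 0` this is an equality, also at `x = 0`, where both sides take the default value `0`.
-/
theorem le_regCoulombPred (ν : ℕ) (x : ℝ) : 1 / √(x ^ 2 + ν) ≤ regCoulombPred ν x := by
  cases ν with
  | zero => simp [regCoulombPred, Real.sqrt_sq_eq_abs]
  | succ m => simpa [regCoulombPred] using le_regCoulomb m x

theorem le_scaled_regCoulombPred (ν : ℕ) (x : ℝ) :
    1 / √(x ^ 2 + 2 * ν) ≤ 1 / √2 * regCoulombPred ν (x / √2) := by
  refine le_trans (le_of_eq ?_) (mul_le_mul_of_nonneg_left (le_regCoulombPred ν _) (by positivity))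
  rw [one_div_mul_one_div, ← Real.sqrt_mul (by norm_num), div_pow, Real.sq_sqrt (by norm_num)]
  congr 2
  ring

theorem scaled_regCoulombPred_nonneg (ν : ℕ) (x : ℝ) :
    0 ≤ 1 / √2 * regCoulombPred ν (x / √2) :=
  le_trans (by positivity) (le_scaled_regCoulombPred ν x)

/-! ### The bounded weight -/

/-- The smooth bounded weight `φ / (1 + ε φ)` with `φ(x) = √(x² + s)`. -/
noncomputable def weight (ε s x : ℝ) : ℝ := √(x ^ 2 + s) / (1 + ε * √(x ^ 2 + s))

/-- The derivative of `weight`. -/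
noncomputable def weightDeriv (ε s x : ℝ) : ℝ :=
  x / √(x ^ 2 + s) / (1 + ε * √(x ^ 2 + s)) ^ 2

section Weight

variable {ε s : ℝ}

theorem contDiff_sqrt_sq_add (hs : 0 < s) : ContDiff ℝ ∞ fun x : ℝ => √(x ^ 2 + s) :=
  ContDiff.sqrt (by fun_prop) fun x => by positivity

theorem contDiff_weight (hε : 0 < ε) (hs : 0 < s) : ContDiff ℝ ∞ (weight ε s) :=
  (contDiff_sqrt_sq_add hs).div (contDiff_const.add (contDiff_const.mul (contDiff_sqrt_sq_add hs)))
    fun x => by positivity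

theorem weight_pos (hε : 0 < ε) (hs : 0 < s) (x : ℝ) : 0 < weight ε s x := by
  unfold weight
  positivity

theorem mul_weight_le_one (hε : 0 < ε) (hs : 0 < s) (x : ℝ) : ε * weight ε s x ≤ 1 := by
  unfold weight
  rw [← mul_div_assoc, div_le_one (by positivity)]
  linarith

theorem weight_le_inv (hε : 0 < ε) (hs : 0 < s) (x : ℝ) : weight ε s x ≤ ε⁻¹ := by
  rw [← one_div, le_div_iff₀ hε, mul_comm]
  exact mul_weight_le_one hε hs x

theorem hasDerivAt_weight (hε : 0 < ε) (hs : 0 < s) (x : ℝ) :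
    HasDerivAt (weight ε s) (weightDeriv ε s x) x := by
  have hφ : 0 < √(x ^ 2 + s) := by positivity
  have h1 : HasDerivAt (fun x : ℝ => √(x ^ 2 + s)) (x / √(x ^ 2 + s)) x := by
    have := (((hasDerivAt_id x).pow 2).add_const s).sqrt (by simp; positivity)
    refine this.congr_deriv ?_
    simp
    field_simp
  refine (h1.div ((h1.const_mul ε).const_add 1) (by positivity)).congr_deriv ?_
  unfold weightDeriv
  field_simp
  ring

/-- Controls the localization error density `w'² / w` by `1/√(x² + 1)`, uniformly in `ε` and in `s ≥
1`: one has `w'² ≤ (1 + εφ)⁻⁴ ≤ (1 + εφ)⁻¹ = w/φ`. -/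
theorem sq_weightDeriv_le (hε : 0 < ε) (hs : 1 ≤ s) (x : ℝ) :
    weightDeriv ε s x ^ 2 ≤ weight ε s x * (1 / √(x ^ 2 + 1)) := by
  have hs0 : 0 < s := by linarith
  unfold weight weightDeriv
  set φ := √(x ^ 2 + s) with hφd
  have hφ : 0 < φ := by positivity
  have hφ2 : φ ^ 2 = x ^ 2 + s := Real.sq_sqrt (by positivity)
  have hU : 1 / φ ≤ 1 / √(x ^ 2 + 1) := by
    apply one_div_le_one_div_of_le (by positivity)
    exact Real.sqrt_le_sqrt (by linarith)
  have h1 : 1 ≤ 1 + ε * φ := by nlinarith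
  have h2 : (x / φ) ^ 2 ≤ 1 := by
    rw [div_pow, div_le_one (by positivity)]
    linarith
  calc (x / φ / (1 + ε * φ) ^ 2) ^ 2 = (x / φ) ^ 2 / (1 + ε * φ) ^ 4 := by
        rw [div_pow, ← pow_mul]
    _ ≤ 1 / (1 + ε * φ) ^ 4 := by gcongr
    _ ≤ 1 / (1 + ε * φ) := by
        apply one_div_le_one_div_of_le (by positivity)
        exact le_self_pow₀ h1 (by norm_num)
    _ = φ / (1 + ε * φ) * (1 / φ) := by field_simp
    _ ≤ _ := by gcongr

theorem abs_weightDeriv_le_one (hε : 0 < ε) (hs : 0 < s) (x : ℝ) : |weightDeriv ε s x| ≤ 1 := by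
  have hφ : 0 < √(x ^ 2 + s) := by positivity
  have h2 : |x| ≤ √(x ^ 2 + s) := Real.abs_le_sqrt (by linarith)
  unfold weightDeriv
  rw [abs_div, abs_div, abs_of_pos hφ, abs_of_pos (by positivity : 0 < (1 + ε * √(x ^ 2 + s)) ^ 2)]
  have h1 : 1 ≤ 1 + ε * √(x ^ 2 + s) := by nlinarith
  rw [div_le_one (by positivity)]
  exact ((div_le_one hφ).2 h2).trans (one_le_pow₀ h1)

theorem mul_weight_le_three (hε : 0 < ε) (hs : 0 < s) {x v : ℝ} (hv : v ≤ 3 / √(x ^ 2 + s)) :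
    v * weight ε s x ≤ 3 := by
  have hφ : 0 < √(x ^ 2 + s) := by positivity
  calc v * weight ε s x ≤ 3 / √(x ^ 2 + s) * weight ε s x :=
        mul_le_mul_of_nonneg_right hv (weight_pos hε hs x).le
    _ = 3 / (1 + ε * √(x ^ 2 + s)) := by
        unfold weight
        field_simp
    _ ≤ 3 / 1 := by
        gcongr
        nlinarith
    _ = 3 := by norm_num

/-- By Cauchy–Schwarz `φ(x)φ(y) ≥ |xy| + s`, hence `(φ(x) + φ(y))² ≥ (x - y)² + 4s`. Without the
cutoff the right side would therefore be at least `1`; the `ε` terms on the left pay for the cutoff.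
-/
theorem one_sub_weight_le (hε : 0 < ε) (hs : 0 < s) {x y v : ℝ}
    (hv : 1 / √((x - y) ^ 2 + 4 * s) ≤ v) :
    1 - ε * weight ε s x - ε * weight ε s y ≤ v * (weight ε s x + weight ε s y) := by
  have hxp := (weight_pos hε hs x).le
  have hyp := (weight_pos hε hs y).le
  refine le_trans ?_ (mul_le_mul_of_nonneg_right hv (by positivity))
  unfold weight
  set a := √(x ^ 2 + s) with had
  set b := √(y ^ 2 + s) with hbd
  have ha : 0 < a := by positivity
  have hb : 0 < b := by positivity
  have ha2 : a ^ 2 = x ^ 2 + s := Real.sq_sqrt (by positivity)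
  have hb2 : b ^ 2 = y ^ 2 + s := Real.sq_sqrt (by positivity)
  have hab : |x * y| + s ≤ a * b := by
    rw [had, hbd, ← Real.sqrt_mul (by positivity)]
    apply Real.le_sqrt_of_sq_le
    rw [add_sq, sq_abs]
    have : 2 * |x * y| ≤ x ^ 2 + y ^ 2 := by
      rw [abs_mul]
      nlinarith [sq_nonneg (|x| - |y|), sq_abs x, sq_abs y]
    nlinarith
  have h1 : √((x - y) ^ 2 + 4 * s) ≤ a + b := by
    rw [Real.sqrt_le_left (by positivity)]
    nlinarith [neg_abs_le (x * y)]
  have h2 : 1 / (a + b) ≤ 1 / √((x - y) ^ 2 + 4 * s) :=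
    one_div_le_one_div_of_le (by positivity) h1
  refine le_trans ?_ (mul_le_mul_of_nonneg_right h2 (by positivity))
  have h3 : 1 / (a + b) * (a / (1 + ε * a) + b / (1 + ε * b))
      - (1 - ε * (a / (1 + ε * a)) - ε * (b / (1 + ε * b)))
      = (2 * ε * a * b + ε ^ 2 * a * b * (a + b)) / ((a + b) * (1 + ε * a) * (1 + ε * b)) := by
    field_simp
    ring
  have : 0 ≤ 1 / (a + b) * (a / (1 + ε * a) + b / (1 + ε * b))
      - (1 - ε * (a / (1 + ε * a)) - ε * (b / (1 + ε * b))) := by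
    rw [h3]
    positivity
  linarith

end Weight

/-! ### The damping factor of the trial state -/

/-- `√(1 - t w)`, with `w` the bounded weight. -/
noncomputable def damping (t ε s x : ℝ) : ℝ := √(1 - t * weight ε s x)

section Damping

variable {t ε s : ℝ}

theorem half_le_one_sub_mul_weight (hε : 0 < ε) (hs : 0 < s) (ht : 0 ≤ t) (htε : 2 * t ≤ ε)
    (x : ℝ) : 1 / 2 ≤ 1 - t * weight ε s x := by
  have h1 := mul_weight_le_one hε hs x
  have h2 := (weight_pos hε hs x).le
  nlinarith

theorem sq_damping (hε : 0 < ε) (hs : 0 < s) (ht : 0 ≤ t) (htε : 2 * t ≤ ε) (x : ℝ) :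
    damping t ε s x ^ 2 = 1 - t * weight ε s x :=
  Real.sq_sqrt (by linarith [half_le_one_sub_mul_weight hε hs ht htε x])

theorem contDiff_damping (hε : 0 < ε) (hs : 0 < s) (ht : 0 ≤ t) (htε : 2 * t ≤ ε) :
    ContDiff ℝ ∞ (damping t ε s) :=
  (contDiff_const.sub (contDiff_const.mul (contDiff_weight hε hs))).sqrt fun x => by
    linarith [half_le_one_sub_mul_weight hε hs ht htε x]

theorem damping_pos (hε : 0 < ε) (hs : 0 < s) (ht : 0 ≤ t) (htε : 2 * t ≤ ε) (x : ℝ) :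
    0 < damping t ε s x :=
  Real.sqrt_pos.2 (by linarith [half_le_one_sub_mul_weight hε hs ht htε x])

theorem abs_damping_le_one (hε : 0 < ε) (hs : 0 < s) (ht : 0 ≤ t) (x : ℝ) :
    |damping t ε s x| ≤ 1 := by
  unfold damping
  rw [abs_of_nonneg (Real.sqrt_nonneg _), Real.sqrt_le_one]
  nlinarith [weight_pos hε hs x]

theorem hasDerivAt_damping (hε : 0 < ε) (hs : 0 < s) (ht : 0 ≤ t) (htε : 2 * t ≤ ε) (x : ℝ) :
    HasDerivAt (damping t ε s) (-(t * weightDeriv ε s x) / (2 * damping t ε s x)) x :=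
  (((hasDerivAt_weight hε hs x).const_mul t).const_sub 1).sqrt
    (by linarith [half_le_one_sub_mul_weight hε hs ht htε x])

theorem sq_damping_deriv_le (hε : 0 < ε) (hs : 0 < s) (ht : 0 ≤ t) (htε : 2 * t ≤ ε) (x : ℝ) :
    (-(t * weightDeriv ε s x) / (2 * damping t ε s x)) ^ 2 ≤ t ^ 2 := by
  have h1 := half_le_one_sub_mul_weight hε hs ht htε x
  have h2 : weightDeriv ε s x ^ 2 ≤ 1 := by
    rw [sq_le_one_iff_abs_le_one]
    exact abs_weightDeriv_le_one hε hs x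
  rw [div_pow, mul_pow, sq_damping hε hs ht htε, div_le_iff₀ (by linarith), neg_sq, mul_pow]
  nlinarith [sq_nonneg t]

end Damping

/-! ### A primitive bounded by `log L` -/

/-- A bounded primitive of `1 / √(x² + 1) - 1 / √(x² + L²)`. -/
noncomputable def logPrimitive (L x : ℝ) : ℝ := Real.arsinh x - Real.arsinh (x / L)

section LogPrimitive

variable {L : ℝ}

theorem contDiff_logPrimitive : ContDiff ℝ ∞ (logPrimitive L) :=
  Real.contDiff_arsinh.sub (Real.contDiff_arsinh.comp (contDiff_id.div_const L))

theorem hasDerivAt_logPrimitive (hL : 0 < L) (x : ℝ) :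
    HasDerivAt (logPrimitive L) (1 / √(x ^ 2 + 1) - 1 / √(x ^ 2 + L ^ 2)) x := by
  have h := (Real.hasDerivAt_arsinh x).sub
    ((Real.hasDerivAt_arsinh (x / L)).comp x ((hasDerivAt_id x).div_const L))
  refine h.congr_deriv ?_
  have h1 : √(x ^ 2 + L ^ 2) = √(1 + (x / L) ^ 2) * L := by
    conv_rhs => rw [← Real.sqrt_sq hL.le, ← Real.sqrt_mul (by positivity), Real.sqrt_sq hL.le]
    congr 1
    field_simp
    ring
  rw [h1]
  simp only [add_comm (x ^ 2), one_div, mul_inv]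

theorem logPrimitive_nonneg_le (hL : 1 ≤ L) {x : ℝ} (hx : 0 ≤ x) :
    0 ≤ logPrimitive L x ∧ logPrimitive L x ≤ Real.log L := by
  have hL0 : 0 < L := by linarith
  unfold logPrimitive
  constructor
  · rw [sub_nonneg, Real.arsinh_le_arsinh]
    exact div_le_self hx hL
  · have h1 : √(x ^ 2 + L ^ 2) = L * √(1 + (x / L) ^ 2) := by
      conv_rhs => rw [← Real.sqrt_sq hL0.le, ← Real.sqrt_mul (by positivity), Real.sqrt_sq hL0.le]
      congr 1
      field_simp
      ring
    have h2 : Real.log L + Real.arsinh (x / L) = Real.log (x + √(x ^ 2 + L ^ 2)) := by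
      unfold Real.arsinh
      rw [← Real.log_mul (by positivity) (by positivity), mul_add, ← h1]
      congr 2
      field_simp
    have h3 : Real.arsinh x ≤ Real.log (x + √(x ^ 2 + L ^ 2)) := by
      unfold Real.arsinh
      apply Real.log_le_log (by positivity)
      have : √(1 + x ^ 2) ≤ √(x ^ 2 + L ^ 2) := Real.sqrt_le_sqrt (by nlinarith)
      linarith
    linarith

theorem abs_logPrimitive_le (hL : 1 ≤ L) (x : ℝ) : |logPrimitive L x| ≤ Real.log L := by
  rcases le_total 0 x with hx | hx
  · obtain ⟨h1, h2⟩ := logPrimitive_nonneg_le hL hx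
    rwa [abs_of_nonneg h1]
  · obtain ⟨h1, h2⟩ := logPrimitive_nonneg_le hL (neg_nonneg.2 hx)
    have h3 : logPrimitive L (-x) = -logPrimitive L x := by
      unfold logPrimitive
      rw [neg_div, Real.arsinh_neg, Real.arsinh_neg]
      ring
    rw [← abs_neg, ← h3, abs_of_nonneg h1]
    exact h2

theorem abs_logPrimitive_deriv_le (x : ℝ) (hL : 1 ≤ L) :
    |1 / √(x ^ 2 + 1) - 1 / √(x ^ 2 + L ^ 2)| ≤ 1 := by
  have h1 : 1 / √(x ^ 2 + 1) ≤ 1 := by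
    rw [div_le_one (by positivity)]
    exact Real.one_le_sqrt.2 (by nlinarith)
  have h2 : 1 / √(x ^ 2 + L ^ 2) ≤ 1 := by
    rw [div_le_one (by positivity)]
    exact Real.one_le_sqrt.2 (by nlinarith)
  have h3 : 0 ≤ 1 / √(x ^ 2 + 1) := by positivity
  have h4 : 0 ≤ 1 / √(x ^ 2 + L ^ 2) := by positivity
  rw [abs_le]
  constructor <;> linarith

end LogPrimitive

/-! ### Multipliers and integration by parts in `H¹` -/

section Sobolev

variable {ι : Type*} [Fintype ι] [LinearOrder ι]

theorem eLpNorm_smul_le {α : Type*} [MeasurableSpace α] {μ : Measure α} {c : α → ℝ} {C : ℝ}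
    (hc : ∀ x, |c x| ≤ C) (u : α → ℂ) :
    eLpNorm (fun x => c x • u x) 2 μ ≤ ENNReal.ofReal C * eLpNorm u 2 μ := by
  refine eLpNorm_le_mul_eLpNorm_of_ae_le_mul (Eventually.of_forall fun x => ?_) 2
  rw [norm_smul, Real.norm_eq_abs]
  exact mul_le_mul_of_nonneg_right (hc x) (norm_nonneg _)

theorem memLp_smul_of_bdd {α : Type*} [MeasurableSpace α] {μ : Measure α} {c : α → ℝ} {C : ℝ}
    (hm : AEStronglyMeasurable c μ) (hc : ∀ x, |c x| ≤ C) {u : α → ℂ} (hu : MemLp u 2 μ) :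
    MemLp (fun x => c x • u x) 2 μ :=
  ⟨hm.smul hu.1, (eLpNorm_smul_le hc u).trans_lt (ENNReal.mul_lt_top ENNReal.ofReal_lt_top hu.2)⟩

theorem tendsto_eLpNorm_smul_sub {α : Type*} [MeasurableSpace α] {μ : Measure α} {c : α → ℝ}
    {C : ℝ} (hc : ∀ x, |c x| ≤ C) {u : ℕ → α → ℂ} {v : α → ℂ}
    (hu : Tendsto (fun n => eLpNorm (fun x => u n x - v x) 2 μ) atTop (𝓝 0)) :
    Tendsto (fun n => eLpNorm (fun x => c x • u n x - c x • v x) 2 μ) atTop (𝓝 0) := by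
  have h0 : Tendsto (fun n => ENNReal.ofReal C * eLpNorm (fun x => u n x - v x) 2 μ)
      atTop (𝓝 0) := by
    simpa using ENNReal.Tendsto.const_mul hu (Or.inr ENNReal.ofReal_ne_top)
  refine tendsto_of_tendsto_of_tendsto_of_le_of_le tendsto_const_nhds h0 (fun _ => zero_le)
    fun n => ?_
  simp only [← smul_sub]
  exact eLpNorm_smul_le hc _

theorem tendsto_eLpNorm_add_sub {α : Type*} [MeasurableSpace α] {μ : Measure α}
    {u v : ℕ → α → ℂ} {a b : α → ℂ} (hum : ∀ n, AEStronglyMeasurable (u n) μ)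
    (ham : AEStronglyMeasurable a μ) (hvm : ∀ n, AEStronglyMeasurable (v n) μ)
    (hbm : AEStronglyMeasurable b μ)
    (hu : Tendsto (fun n => eLpNorm (fun x => u n x - a x) 2 μ) atTop (𝓝 0))
    (hv : Tendsto (fun n => eLpNorm (fun x => v n x - b x) 2 μ) atTop (𝓝 0)) :
    Tendsto (fun n => eLpNorm (fun x => (u n x + v n x) - (a x + b x)) 2 μ) atTop (𝓝 0) := by
  have h0 := hu.add hv
  rw [add_zero] at h0
  refine tendsto_of_tendsto_of_tendsto_of_le_of_le tendsto_const_nhds h0 (fun _ => zero_le)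
    fun n => ?_
  simp only [add_sub_add_comm]
  exact eLpNorm_add_le ((hum n).sub ham) ((hvm n).sub hbm) (by norm_num)

/-- Multiplication by a smooth function with bounded gradient preserves `H¹`. -/
theorem HasSobolevGradient.smul {Φ : (ι → ℝ) → ℂ} {g : ι → (ι → ℝ) → ℂ}
    (h : HasSobolevGradient Φ g) {χ : (ι → ℝ) → ℝ} (hχ : ContDiff ℝ ∞ χ) {C : ℝ}
    (hC : ∀ x, |χ x| ≤ C) {d : ι → (ι → ℝ) → ℝ} (hd : ∀ i x, fderiv ℝ χ x (Pi.single i 1) = d i x)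
    (hD : ∀ i x, |d i x| ≤ C) :
    HasSobolevGradient (fun x => χ x • Φ x) (fun i x => χ x • g i x + d i x • Φ x) := by
  obtain ⟨hΦ, hg, φ, hφ, hφΦ, hφg⟩ := h
  have hχm : AEStronglyMeasurable χ volume := hχ.continuous.aestronglyMeasurable
  have hdm : ∀ i, AEStronglyMeasurable (d i) volume := fun i => by
    have : d i = fun x => fderiv ℝ χ x (Pi.single i 1) := funext fun x => (hd i x).symm
    rw [this]
    exact ((hχ.continuous_fderiv (by simp)).clm_apply continuous_const).aestronglyMeasurable
  have hφm : ∀ n, AEStronglyMeasurable (φ n) volume := fun n =>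
    (hφ n).1.continuous.aestronglyMeasurable
  have hφdm : ∀ n i, AEStronglyMeasurable (fun x => fderiv ℝ (φ n) x (Pi.single i 1)) volume :=
    fun n i => (((hφ n).1.continuous_fderiv (by simp)).clm_apply
      continuous_const).aestronglyMeasurable
  have hsupp : ∀ n, HasCompactSupport fun x => χ x • φ n x := fun n =>
    (hφ n).2.mono fun x hx h0 => hx (by simp [h0])
  refine ⟨memLp_smul_of_bdd hχm hC hΦ, fun i => (memLp_smul_of_bdd hχm hC (hg i)).add
    (memLp_smul_of_bdd (hdm i) (hD i) hΦ), fun n x => χ x • φ n x,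
    fun n => ⟨hχ.smul (hφ n).1, hsupp n⟩, ?_, fun i => ?_⟩
  · exact tendsto_eLpNorm_smul_sub hC hφΦ
  · have heq : ∀ n x, fderiv ℝ (fun x => χ x • φ n x) x (Pi.single i 1)
        = χ x • fderiv ℝ (φ n) x (Pi.single i 1) + d i x • φ n x := by
      intro n x
      have h1 : DifferentiableAt ℝ χ x := (hχ.differentiable (by simp)) x
      have h2 : DifferentiableAt ℝ (φ n) x := ((hφ n).1.differentiable (by simp)) x
      rw [fderiv_fun_smul h1 h2]
      simp only [add_apply, smul_apply,
        ContinuousLinearMap.smulRight_apply, hd]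
    simp only [heq]
    exact tendsto_eLpNorm_add_sub (fun n => hχm.smul (hφdm n i)) (hχm.smul (hg i).1)
      (fun n => (hdm i).smul (hφm n)) ((hdm i).smul hΦ.1)
      (tendsto_eLpNorm_smul_sub hC (hφg i)) (tendsto_eLpNorm_smul_sub (hD i) hφΦ)

/-- Multiplication by a bounded smooth function of one coordinate. -/
theorem HasSobolevGradient.smul_coord {Φ : (ι → ℝ) → ℂ} {g : ι → (ι → ℝ) → ℂ}
    (h : HasSobolevGradient Φ g) (k : ι) {f f' : ℝ → ℝ} (hf : ContDiff ℝ ∞ f)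
    (hf' : ∀ x, HasDerivAt f (f' x) x) {C : ℝ} (hC : ∀ x, |f x| ≤ C) (hD : ∀ x, |f' x| ≤ C) :
    HasSobolevGradient (fun x => f (x k) • Φ x)
      (fun i x => f (x k) • g i x + (if i = k then f' (x k) else 0) • Φ x) := by
  have hC0 : 0 ≤ C := (abs_nonneg _).trans (hC 0)
  refine h.smul (χ := fun x => f (x k)) (hf.comp (contDiff_apply ℝ ℝ k)) (fun x => hC _)
    (d := fun i x => if i = k then f' (x k) else 0) (fun i x => ?_) (fun i x => ?_)
  · have h1 : HasFDerivAt (fun x : ι → ℝ => f (x k))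
        (f' (x k) • (ContinuousLinearMap.proj k : (ι → ℝ) →L[ℝ] ℝ)) x :=
      (hf' (x k)).comp_hasFDerivAt x (hasFDerivAt_apply k x)
    rw [h1.fderiv]
    simp [Pi.single_apply, eq_comm]
  · split_ifs
    · exact hD _
    · simpa using hC0

theorem HasSobolevGradient.const_smul {Φ : (ι → ℝ) → ℂ} {g : ι → (ι → ℝ) → ℂ}
    (h : HasSobolevGradient Φ g) (c : ℝ) :
    HasSobolevGradient (fun x => c • Φ x) (fun i x => c • g i x) := by
  have := h.smul (χ := fun _ => c) contDiff_const (C := |c|) (fun _ => le_rfl)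
    (d := fun _ _ => 0) (by simp) (by simp)
  simpa using this

theorem integrable_bdd_mul_sq {α : Type*} [MeasurableSpace α] {μ : Measure α} {Φ : α → ℂ}
    (hΦ : MemLp Φ 2 μ) {F : α → ℝ} (hF : AEStronglyMeasurable F μ) {C : ℝ}
    (hC : ∀ x, |F x| ≤ C) : Integrable (fun x => F x * ‖Φ x‖ ^ 2) μ :=
  (hΦ.integrable_norm_pow (p := 2) (by norm_num)).bdd_mul hF (Eventually.of_forall hC)

theorem integrable_inner_of_memLp {α : Type*} [MeasurableSpace α] {μ : Measure α} {Φ g : α → ℂ}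
    (hΦ : MemLp Φ 2 μ) (hg : MemLp g 2 μ) : Integrable (fun x => inner ℝ (Φ x) (g x)) μ := by
  refine (L2.integrable_inner (𝕜 := ℝ) (hΦ.toLp Φ) (hg.toLp g)).congr ?_
  filter_upwards [hΦ.coeFn_toLp, hg.coeFn_toLp] with x hx hy
  rw [hx, hy]

theorem integrable_bdd_mul_inner {α : Type*} [MeasurableSpace α] {μ : Measure α} {Φ g : α → ℂ}
    (hΦ : MemLp Φ 2 μ) (hg : MemLp g 2 μ) {F : α → ℝ} (hF : AEStronglyMeasurable F μ) {C : ℝ}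
    (hC : ∀ x, |F x| ≤ C) : Integrable (fun x => F x * inner ℝ (Φ x) (g x)) μ :=
  (integrable_inner_of_memLp hΦ hg).bdd_mul hF (Eventually.of_forall hC)

theorem tendsto_integral_inner {α : Type*} [MeasurableSpace α] {μ : Measure α}
    {u v : ℕ → α → ℂ} {Φ g : α → ℂ} (hu : ∀ n, MemLp (u n) 2 μ) (hv : ∀ n, MemLp (v n) 2 μ)
    (hΦ : MemLp Φ 2 μ) (hg : MemLp g 2 μ)
    (huΦ : Tendsto (fun n => eLpNorm (fun x => u n x - Φ x) 2 μ) atTop (𝓝 0))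
    (hvg : Tendsto (fun n => eLpNorm (fun x => v n x - g x) 2 μ) atTop (𝓝 0)) :
    Tendsto (fun n => ∫ x, inner ℝ (u n x) (v n x) ∂μ) atTop (𝓝 (∫ x, inner ℝ (Φ x) (g x) ∂μ)) := by
  have h1 := (Lp.tendsto_Lp_iff_tendsto_eLpNorm'' u hu Φ hΦ).2 huΦ
  have h2 := (Lp.tendsto_Lp_iff_tendsto_eLpNorm'' v hv g hg).2 hvg
  have key : ∀ {a b : α → ℂ} (ha : MemLp a 2 μ) (hb : MemLp b 2 μ),
      inner ℝ (ha.toLp a) (hb.toLp b) = ∫ x, inner ℝ (a x) (b x) ∂μ := fun ha hb => by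
    rw [L2.inner_def]
    refine integral_congr_ae ?_
    filter_upwards [ha.coeFn_toLp, hb.coeFn_toLp] with x hx hy
    rw [hx, hy]
  have h3 := h1.inner (𝕜 := ℝ) h2
  simpa only [key] using h3

/-- Integration by parts in one coordinate. -/
theorem HasSobolevGradient.integral_deriv_mul_sq {Φ : (ι → ℝ) → ℂ} {g : ι → (ι → ℝ) → ℂ}
    (h : HasSobolevGradient Φ g) (k : ι) {f f' : ℝ → ℝ} (hf : ContDiff ℝ ∞ f)
    (hf' : ∀ x, HasDerivAt f (f' x) x) {C : ℝ} (hC : ∀ x, |f x| ≤ C) (hD : ∀ x, |f' x| ≤ C) :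
    ∫ x, f' (x k) * ‖Φ x‖ ^ 2 = -(2 * ∫ x, f (x k) * inner ℝ (Φ x) (g k x)) := by
  obtain ⟨hΦ, hg, φ, hφ, hφΦ, hφg⟩ := h
  have hfc : Continuous fun x : ι → ℝ => f (x k) := hf.continuous.comp (continuous_apply k)
  have hf'c : Continuous f' := by
    have : f' = deriv f := funext fun x => (hf' x).deriv.symm
    rw [this]
    exact hf.continuous_deriv (by simp)
  have hf'm : AEStronglyMeasurable (fun x : ι → ℝ => f' (x k)) volume :=
    (hf'c.comp (continuous_apply k)).aestronglyMeasurable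
  have hfm : AEStronglyMeasurable (fun x : ι → ℝ => f (x k)) volume := hfc.aestronglyMeasurable
  have hdc : ∀ n, Continuous fun x => fderiv ℝ (φ n) x (Pi.single k 1) := fun n =>
    ((hφ n).1.continuous_fderiv (by simp)).clm_apply continuous_const
  have hds : ∀ n, HasCompactSupport fun x => fderiv ℝ (φ n) x (Pi.single k 1) := fun n =>
    (hφ n).2.fderiv_apply (𝕜 := ℝ) _
  have hφL : ∀ n, MemLp (φ n) 2 volume := fun n =>
    (hφ n).1.continuous.memLp_of_hasCompactSupport (hφ n).2
  have hdL : ∀ n, MemLp (fun x => fderiv ℝ (φ n) x (Pi.single k 1)) 2 volume := fun n =>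
    (hdc n).memLp_of_hasCompactSupport (hds n)
  -- The identity is proved for the smooth approximants; both sides are `L²` inner products, so they
  -- pass to the limit.
  have hsmooth : ∀ n, ∫ x, f' (x k) * ‖φ n x‖ ^ 2 =
      -(2 * ∫ x, f (x k) * inner ℝ (φ n x) (fderiv ℝ (φ n) x (Pi.single k 1))) := by
    intro n
    have hd1 : ∀ x, HasFDerivAt (fun x : ι → ℝ => f (x k))
        (f' (x k) • (ContinuousLinearMap.proj k : (ι → ℝ) →L[ℝ] ℝ)) x := fun x =>
      (hf' (x k)).comp_hasFDerivAt x (hasFDerivAt_apply k x)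
    have hd2 : ∀ x, HasFDerivAt (fun x => ‖φ n x‖ ^ 2)
        (2 • (innerSL ℝ (φ n x)).comp (fderiv ℝ (φ n) x)) x := fun x =>
      ((hφ n).1.differentiable (by simp) x).hasFDerivAt.norm_sq
    have e1 : ∀ x, fderiv ℝ (fun x : ι → ℝ => f (x k)) x (Pi.single k 1) = f' (x k) := fun x => by
      rw [(hd1 x).fderiv]
      simp
    have e2 : ∀ x, fderiv ℝ (fun x => ‖φ n x‖ ^ 2) x (Pi.single k 1) =
        2 * inner ℝ (φ n x) (fderiv ℝ (φ n) x (Pi.single k 1)) := fun x => by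
      rw [(hd2 x).fderiv, two_smul]
      simp only [add_apply, ContinuousLinearMap.comp_apply, innerSL_apply_apply]
      ring
    have i1 : Integrable (fun x => f' (x k) * ‖φ n x‖ ^ 2) volume :=
      integrable_bdd_mul_sq (hφL n) hf'm (fun x => hD _)
    have i2 : Integrable (fun x => f (x k) *
        (2 * inner ℝ (φ n x) (fderiv ℝ (φ n) x (Pi.single k 1)))) volume := by
      refine ((integrable_bdd_mul_inner (hφL n) (hdL n) hfm (fun x => hC _)).const_mul 2).congr
        (Eventually.of_forall fun x => ?_)
      simp only
      ring
    have hibp := integral_mul_fderiv_eq_neg_fderiv_mul_of_integrable (μ := (volume : Measure (ι → ℝ)))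
      (f := fun x : ι → ℝ => f (x k)) (g := fun x => ‖φ n x‖ ^ 2) (v := Pi.single k 1)
      (by simpa only [e1] using i1) (by simpa only [e2] using i2)
      (integrable_bdd_mul_sq (hφL n) hfm (fun x => hC _))
      (fun x _ => (hd1 x).differentiableAt) (fun x _ => (hd2 x).differentiableAt)
    simp only [e1, e2] at hibp
    rw [eq_comm, neg_eq_iff_eq_neg, ← hibp, ← integral_const_mul]
    congr 1
    funext x
    ring
  have l1 := tendsto_integral_inner (u := fun n x => f' (x k) • φ n x) (v := φ)
    (Φ := fun x => f' (x k) • Φ x)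
    (fun n => memLp_smul_of_bdd hf'm (fun x => hD _) (hφL n)) hφL
    (memLp_smul_of_bdd hf'm (fun x => hD _) hΦ) hΦ
    (tendsto_eLpNorm_smul_sub (c := fun x : ι → ℝ => f' (x k)) (fun x => hD _) hφΦ) hφΦ
  have l2 := tendsto_integral_inner (u := fun n x => f (x k) • φ n x)
    (v := fun n x => fderiv ℝ (φ n) x (Pi.single k 1)) (Φ := fun x => f (x k) • Φ x)
    (fun n => memLp_smul_of_bdd hfm (fun x => hC _) (hφL n)) hdL
    (memLp_smul_of_bdd hfm (fun x => hC _) hΦ) (hg k)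
    (tendsto_eLpNorm_smul_sub (c := fun x : ι → ℝ => f (x k)) (fun x => hC _) hφΦ) (hφg k)
  simp only [real_inner_smul_left, real_inner_self_eq_norm_sq] at l1 l2
  simp only [hsmooth] at l1
  exact tendsto_nhds_unique l1 ((l2.const_mul 2).neg)

end Sobolev

/-! ### Slices of `H¹` functions at a fixed coordinate -/

/-- Indices with integrals at most `2⁻ʲ` make the sum over `j` integrable, hence finite almost
everywhere, so its terms tend to zero there. -/
theorem exists_seq_tendsto_zero_ae_of_lintegral {α : Type*} [MeasurableSpace α] {μ : Measure α}
    {S : ℕ → α → ENNReal} (hS : ∀ n, AEMeasurable (S n) μ)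
    (h : Tendsto (fun n => ∫⁻ x, S n x ∂μ) atTop (𝓝 0)) :
    ∃ ns : ℕ → ℕ, ∀ᵐ x ∂μ, Tendsto (fun j => S (ns j) x) atTop (𝓝 0) := by
  have hex : ∀ j : ℕ, ∃ n, ∫⁻ x, S n x ∂μ ≤ (2⁻¹ : ENNReal) ^ j := fun j =>
    (h.eventually (ge_mem_nhds (ENNReal.pow_pos (by simp) j))).exists
  choose ns hns using hex
  refine ⟨ns, ?_⟩
  have hfin : ∫⁻ x, ∑' j, S (ns j) x ∂μ ≠ ⊤ := by
    rw [lintegral_tsum fun j => hS (ns j)]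
    refine ne_top_of_le_ne_top ?_ (ENNReal.tsum_le_tsum hns)
    rw [ENNReal.tsum_geometric]
    simp
  filter_upwards [ae_lt_top' (AEMeasurable.tsum fun j => hS (ns j)) hfin] with x hx
  exact ENNReal.tendsto_atTop_zero_of_tsum_ne_top hx.ne

theorem tendsto_eLpNorm_two_iff {α : Type*} [MeasurableSpace α] {μ : Measure α} {u : ℕ → α → ℂ} :
    Tendsto (fun n => eLpNorm (u n) 2 μ) atTop (𝓝 0) ↔
      Tendsto (fun n => ∫⁻ x, ‖u n x‖ₑ ^ (2 : ℝ) ∂μ) atTop (𝓝 0) := by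
  have h1 : ∀ n, eLpNorm (u n) 2 μ = (∫⁻ x, ‖u n x‖ₑ ^ (2 : ℝ) ∂μ) ^ (2⁻¹ : ℝ) := fun n => by
    rw [eLpNorm_eq_lintegral_rpow_enorm_toReal (by norm_num) (by norm_num)]
    simp
  have h2 : ∀ n, ∫⁻ x, ‖u n x‖ₑ ^ (2 : ℝ) ∂μ = eLpNorm (u n) 2 μ ^ (2 : ℝ) := fun n => by
    rw [h1, ← ENNReal.rpow_mul]
    simp
  constructor
  · intro h
    simp only [h2]
    have := (ENNReal.continuous_rpow_const (y := 2)).tendsto (0 : ENNReal)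
    rw [ENNReal.zero_rpow_of_pos (by norm_num)] at this
    exact this.comp h
  · intro h
    simp only [h1]
    have := (ENNReal.continuous_rpow_const (y := 2⁻¹)).tendsto (0 : ENNReal)
    rw [ENNReal.zero_rpow_of_pos (by norm_num)] at this
    exact this.comp h

section Slice

variable {ι : Type*} [LinearOrder ι]

/-- The point with `k`-th coordinate `t` and remaining coordinates `y`. -/
def joinCoord (k : ι) (p : ({i // ¬ i ≠ k} → ℝ) × ({i // i ≠ k} → ℝ)) : ι → ℝ :=
  (MeasurableEquiv.piEquivPiSubtypeProd (fun _ : ι => ℝ) (fun i => i ≠ k)).symm p.swap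

theorem joinCoord_apply (k : ι) (t : {i // ¬ i ≠ k} → ℝ) (y : {i // i ≠ k} → ℝ) (i : ι) :
    joinCoord k (t, y) i = if h : i ≠ k then y ⟨i, h⟩ else t ⟨i, h⟩ := rfl

theorem joinCoord_self (k : ι) (t : {i // ¬ i ≠ k} → ℝ) (y : {i // i ≠ k} → ℝ) :
    joinCoord k (t, y) k = t ⟨k, not_not.2 rfl⟩ := by
  simp [joinCoord_apply]

theorem joinCoord_subtype (k : ι) (t : {i // ¬ i ≠ k} → ℝ) (y : {i // i ≠ k} → ℝ)
    (j : {i // i ≠ k}) : joinCoord k (t, y) j = y j := by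
  simp [joinCoord_apply, j.2]

theorem measurableEmbedding_joinCoord (k : ι) : MeasurableEmbedding (joinCoord k) :=
  (MeasurableEquiv.prodComm.trans (MeasurableEquiv.piEquivPiSubtypeProd (fun _ : ι => ℝ)
    (fun i => i ≠ k)).symm).measurableEmbedding

theorem hasCompactSupport_comp_joinCoord (k : ι) (t : {i // ¬ i ≠ k} → ℝ) {φ : (ι → ℝ) → ℂ}
    (hφ : HasCompactSupport φ) : HasCompactSupport fun y => φ (joinCoord k (t, y)) := by
  have hc : Continuous fun (x : ι → ℝ) (j : {i // i ≠ k}) => x j := by fun_prop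
  refine HasCompactSupport.intro (hφ.isCompact.image hc) fun y hy => ?_
  refine image_eq_zero_of_notMem_tsupport fun hmem => hy ⟨_, hmem, ?_⟩
  funext j
  exact joinCoord_subtype k t y j

variable [Fintype ι]

theorem measurePreserving_joinCoord (k : ι) :
    MeasurePreserving (joinCoord k) (volume.prod volume) volume := by
  exact ((volume_preserving_piEquivPiSubtypeProd (fun _ : ι => ℝ) (fun i => i ≠ k)).symm).comp
    Measure.measurePreserving_swap

theorem hasFDerivAt_joinCoord (k : ι) (t : {i // ¬ i ≠ k} → ℝ) (y : {i // i ≠ k} → ℝ) :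
    HasFDerivAt (fun y => joinCoord k (t, y))
      (ContinuousLinearMap.pi fun i : ι => if h : i ≠ k then ContinuousLinearMap.proj ⟨i, h⟩ else
        (0 : ({i // i ≠ k} → ℝ) →L[ℝ] ℝ)) y := by
  refine hasFDerivAt_pi.2 fun i => ?_
  by_cases h : i ≠ k
  · simp only [joinCoord_apply, dif_pos h]
    exact hasFDerivAt_apply _ _
  · simp only [joinCoord_apply, dif_neg h]
    exact hasFDerivAt_const _ _

theorem contDiff_joinCoord (k : ι) (t : {i // ¬ i ≠ k} → ℝ) :
    ContDiff ℝ ∞ fun y => joinCoord k (t, y) := by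
  refine contDiff_pi.2 fun i => ?_
  by_cases h : i ≠ k
  · simp only [joinCoord_apply, dif_pos h]
    exact contDiff_apply ℝ ℝ _
  · simp only [joinCoord_apply, dif_neg h]
    exact contDiff_const

theorem fderiv_comp_joinCoord (k : ι) {_ : DecidableEq {i // i ≠ k}} (t : {i // ¬ i ≠ k} → ℝ) (y : {i // i ≠ k} → ℝ)
    {φ : (ι → ℝ) → ℂ} (hφ : Differentiable ℝ φ) (j : {i // i ≠ k}) :
    fderiv ℝ (fun y => φ (joinCoord k (t, y))) y (Pi.single j 1) =
      fderiv ℝ φ (joinCoord k (t, y)) (Pi.single (j : ι) 1) := by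
  have h := (hφ (joinCoord k (t, y))).hasFDerivAt.comp y (hasFDerivAt_joinCoord k t y)
  rw [show (fun y => φ (joinCoord k (t, y))) = φ ∘ fun y => joinCoord k (t, y) from rfl, h.fderiv,
    ContinuousLinearMap.comp_apply]
  congr 1
  funext i
  rw [ContinuousLinearMap.pi_apply]
  by_cases hi : i = k
  · subst hi
    simp [j.2.symm]
  · simp [hi, Pi.single_apply, Subtype.ext_iff]

theorem aestronglyMeasurable_slice (k : ι) {E : Type*} [TopologicalSpace E] {u : (ι → ℝ) → E}
    (hu : AEStronglyMeasurable u volume) :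
    ∀ᵐ t, AEStronglyMeasurable (fun y => u (joinCoord k (t, y))) volume :=
  (hu.comp_measurePreserving (measurePreserving_joinCoord k)).prodMk_left

theorem integrable_slice (k : ι) {u : (ι → ℝ) → ℝ} (hu : Integrable u volume) :
    ∀ᵐ t, Integrable (fun y => u (joinCoord k (t, y))) volume :=
  ((measurePreserving_joinCoord k).integrable_comp_of_integrable hu).prod_right_ae

theorem memLp_slice (k : ι) {u : (ι → ℝ) → ℂ} (hu : MemLp u 2 volume) :
    ∀ᵐ t, MemLp (fun y => u (joinCoord k (t, y))) 2 volume := by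
  filter_upwards [aestronglyMeasurable_slice k hu.1,
    integrable_slice k (hu.integrable_norm_pow (p := 2) (by norm_num))] with t h1 h2
  exact (memLp_two_iff_integrable_sq_norm h1).2 h2

theorem integral_slice (k : ι) {u : (ι → ℝ) → ℝ} (hu : Integrable u volume) :
    ∫ x, u x = ∫ t, ∫ y, u (joinCoord k (t, y)) := by
  rw [← (measurePreserving_joinCoord k).integral_comp (measurableEmbedding_joinCoord k)]
  exact integral_prod _ ((measurePreserving_joinCoord k).integrable_comp_of_integrable hu)

theorem aemeasurable_enorm_comp_joinCoord (k : ι) {v : (ι → ℝ) → ℂ}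
    (hv : AEStronglyMeasurable v volume) :
    AEMeasurable (fun p => ‖v (joinCoord k p)‖ₑ ^ (2 : ℝ)) (volume.prod volume) :=
  ((hv.comp_measurePreserving (measurePreserving_joinCoord k)).enorm).pow_const _

theorem lintegral_slice (k : ι) {v : (ι → ℝ) → ℂ} (hv : AEStronglyMeasurable v volume) :
    ∫⁻ x, ‖v x‖ₑ ^ (2 : ℝ) = ∫⁻ t, ∫⁻ y, ‖v (joinCoord k (t, y))‖ₑ ^ (2 : ℝ) := by
  rw [← (measurePreserving_joinCoord k).lintegral_comp_emb (measurableEmbedding_joinCoord k)]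
  exact lintegral_prod _ (aemeasurable_enorm_comp_joinCoord k hv)

/-- Almost every slice of an `H¹` function at fixed `k`-th coordinate is an `H¹` function. -/
theorem HasSobolevGradient.slice {Φ : (ι → ℝ) → ℂ} {g : ι → (ι → ℝ) → ℂ}
    (h : HasSobolevGradient Φ g) (k : ι) :
    ∀ᵐ t, HasSobolevGradient (fun y => Φ (joinCoord k (t, y)))
      (fun (j : {i // i ≠ k}) y => g j (joinCoord k (t, y))) := by
  obtain ⟨hΦ, hg, φ, hφ, hφΦ, hφg⟩ := h
  have hm0 : ∀ n, AEStronglyMeasurable (fun x => φ n x - Φ x) volume := fun n =>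
    (hφ n).1.continuous.aestronglyMeasurable.sub hΦ.1
  have hmi : ∀ i n, AEStronglyMeasurable
      (fun x => fderiv ℝ (φ n) x (Pi.single i 1) - g i x) volume := fun i n =>
    (((hφ n).1.continuous_fderiv (by simp)).clm_apply
      continuous_const).aestronglyMeasurable.sub (hg i).1
  -- All approximation errors on a slice are added into one function, so that a single subsequence
  -- serves the function and all its derivatives.
  set S : ℕ → ({i // ¬ i ≠ k} → ℝ) → ENNReal := fun n t =>
    (∫⁻ y, ‖φ n (joinCoord k (t, y)) - Φ (joinCoord k (t, y))‖ₑ ^ (2 : ℝ)) +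
      ∑ i, ∫⁻ y, ‖fderiv ℝ (φ n) (joinCoord k (t, y)) (Pi.single i 1)
        - g i (joinCoord k (t, y))‖ₑ ^ (2 : ℝ) with hSdef
  have hM0 : ∀ n, AEMeasurable (fun t => ∫⁻ y : {i // i ≠ k} → ℝ,
      ‖φ n (joinCoord k (t, y)) - Φ (joinCoord k (t, y))‖ₑ ^ (2 : ℝ)) volume := fun n =>
    (aemeasurable_enorm_comp_joinCoord k (hm0 n)).lintegral_prod_right'
  have hMi : ∀ n i, AEMeasurable (fun t => ∫⁻ y : {i // i ≠ k} → ℝ,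
      ‖fderiv ℝ (φ n) (joinCoord k (t, y)) (Pi.single i 1)
        - g i (joinCoord k (t, y))‖ₑ ^ (2 : ℝ)) volume := fun n i =>
    (aemeasurable_enorm_comp_joinCoord k (hmi i n)).lintegral_prod_right'
  have hSm : ∀ n, AEMeasurable (S n) volume := fun n =>
    (hM0 n).add (Finset.aemeasurable_fun_sum _ fun i _ => hMi n i)
  have hS0 : Tendsto (fun n => ∫⁻ t, S n t) atTop (𝓝 0) := by
    have heq : ∀ n, ∫⁻ t, S n t = (∫⁻ x, ‖φ n x - Φ x‖ₑ ^ (2 : ℝ)) +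
        ∑ i, ∫⁻ x, ‖fderiv ℝ (φ n) x (Pi.single i 1) - g i x‖ₑ ^ (2 : ℝ) := by
      intro n
      simp only [hSdef]
      rw [lintegral_add_left' (hM0 n), lintegral_finsetSum' _ fun i _ => hMi n i,
        ← lintegral_slice k (hm0 n)]
      congr 1
      refine Finset.sum_congr rfl fun i _ => ?_
      rw [← lintegral_slice k (hmi i n)]
    simp only [heq]
    have h1 := (tendsto_eLpNorm_two_iff.1 hφΦ).add
      (tendsto_finsetSum Finset.univ fun i _ => tendsto_eLpNorm_two_iff.1 (hφg i))
    simpa using h1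
  obtain ⟨ns, hns⟩ := exists_seq_tendsto_zero_ae_of_lintegral hSm hS0
  filter_upwards [hns, memLp_slice k hΦ, eventually_all.2 fun i => memLp_slice k (hg i)]
    with t ht hΦt hgt
  refine ⟨hΦt, fun j => hgt j, fun n y => φ (ns n) (joinCoord k (t, y)),
    fun n => ⟨(hφ (ns n)).1.comp (contDiff_joinCoord k t),
      hasCompactSupport_comp_joinCoord k t (hφ (ns n)).2⟩, ?_, fun j => ?_⟩
  · rw [tendsto_eLpNorm_two_iff]
    exact tendsto_of_tendsto_of_tendsto_of_le_of_le tendsto_const_nhds ht (fun _ => zero_le)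
      fun n => le_self_add
  · simp only [fderiv_comp_joinCoord k t _ ((hφ _).1.differentiable (by simp))]
    rw [tendsto_eLpNorm_two_iff]
    refine tendsto_of_tendsto_of_tendsto_of_le_of_le tendsto_const_nhds ht (fun _ => zero_le)
      fun n => ?_
    exact (Finset.single_le_sum (f := fun i => ∫⁻ y : {i // i ≠ k} → ℝ,
      ‖fderiv ℝ (φ (ns n)) (joinCoord k (t, y)) (Pi.single i 1)
        - g i (joinCoord k (t, y))‖ₑ ^ (2 : ℝ)) (fun _ _ => zero_le)
        (Finset.mem_univ (j : ι))).trans le_add_self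

/-- A lower bound for an operator in the variables other than `x_k`, integrated over `x_k` against
a weight. -/
theorem weighted_lower_bound_of_slices (k : ι) {c E : ℝ} {U : ({i // i ≠ k} → ℝ) → ℝ}
    (hU : ∀ (χ : ({i // i ≠ k} → ℝ) → ℂ) (γ : {i // i ≠ k} → ({i // i ≠ k} → ℝ) → ℂ),
      HasSobolevGradient χ γ → Integrable (fun y => U y * ‖χ y‖ ^ 2) volume →
      E * ∫ y, ‖χ y‖ ^ 2 ≤ c * (∑ i, ∫ y, ‖γ i y‖ ^ 2) + ∫ y, U y * ‖χ y‖ ^ 2)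
    {Φ : (ι → ℝ) → ℂ} {g : ι → (ι → ℝ) → ℂ} (h : HasSobolevGradient Φ g)
    (hint : Integrable (fun x => U (fun j => x j) * ‖Φ x‖ ^ 2) volume)
    {F : ℝ → ℝ} (hFm : Measurable F) (hF0 : ∀ x, 0 ≤ F x) {C : ℝ} (hFC : ∀ x, |F x| ≤ C) :
    0 ≤ ∫ x, F (x k) * (c * (∑ i : {i // i ≠ k}, ‖g i x‖ ^ 2) + U (fun j => x j) * ‖Φ x‖ ^ 2
      - E * ‖Φ x‖ ^ 2) := by
  have hg2 : ∀ i, Integrable (fun x => ‖g i x‖ ^ 2) volume := fun i =>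
    (h.2.1 i).integrable_norm_pow (p := 2) (by norm_num)
  have hΦ2 : Integrable (fun x => ‖Φ x‖ ^ 2) volume :=
    h.1.integrable_norm_pow (p := 2) (by norm_num)
  have hD : Integrable (fun x => c * (∑ i : {i // i ≠ k}, ‖g i x‖ ^ 2) +
      U (fun j => x j) * ‖Φ x‖ ^ 2 - E * ‖Φ x‖ ^ 2) volume :=
    (((integrable_finsetSum _ fun (i : {i // i ≠ k}) _ => hg2 i).const_mul c).add hint).sub
      (hΦ2.const_mul E)
  have hFk : AEStronglyMeasurable (fun x : ι → ℝ => F (x k)) volume :=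
    (hFm.comp (measurable_pi_apply k)).aestronglyMeasurable
  have hFD := hD.bdd_mul hFk (Eventually.of_forall fun x => hFC _)
  rw [integral_slice k hFD]
  refine integral_nonneg_of_ae ?_
  filter_upwards [h.slice k, integrable_slice k hint] with t ht hit
  simp only [joinCoord_self, joinCoord_subtype] at hit ⊢
  rw [integral_const_mul]
  refine mul_nonneg (hF0 _) ?_
  have h1 : ∀ i : {i // i ≠ k}, Integrable (fun y => ‖g i (joinCoord k (t, y))‖ ^ 2) volume :=
    fun i => (ht.2.1 i).integrable_norm_pow (p := 2) (by norm_num)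
  have h2 : Integrable (fun y => ‖Φ (joinCoord k (t, y))‖ ^ 2) volume :=
    ht.1.integrable_norm_pow (p := 2) (by norm_num)
  have h3 := hU _ _ ht hit
  have h4 : Integrable (fun y => c * ∑ i : {i // i ≠ k}, ‖g i (joinCoord k (t, y))‖ ^ 2) volume :=
    (integrable_finsetSum _ fun i _ => h1 i).const_mul c
  have h5 : Integrable (fun y => c * (∑ i : {i // i ≠ k}, ‖g i (joinCoord k (t, y))‖ ^ 2) +
      U (fun j => y j) * ‖Φ (joinCoord k (t, y))‖ ^ 2) volume := h4.add hit
  rw [integral_sub h5 (h2.const_mul E), integral_add h4 hit,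
    integral_const_mul, integral_const_mul, integral_finsetSum _ fun i _ => h1 i]
  linarith

end Slice

/-! ### Energy forms, particle removal and integrability of the potential terms -/

section Energy

variable {ι : Type*} [LinearOrder ι]

/-- The interaction `W_{jl}(x_j - x_l)` if `j < l`, and `0` otherwise. -/
def pairPotential (W : ι → ι → ℝ → ℝ) (j l : ι) (x : ι → ℝ) : ℝ :=
  if j < l then W j l (x j - x l) else 0

/-- Measurable potentials with attraction at most `3 / √(x² + s)` and nonnegative repulsion at least
`1 / √(x² + 4 s)`. -/
structure CoulombBounds (s : ℝ) (V : ι → ℝ → ℝ) (W : ι → ι → ℝ → ℝ) : Prop where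
  measurable_attraction : ∀ j, Measurable (V j)
  measurable_repulsion : ∀ j k, j < k → Measurable (W j k)
  attraction_le : ∀ j x, V j x ≤ 3 / √(x ^ 2 + s)
  repulsion_nonneg : ∀ j k, j < k → ∀ x, 0 ≤ W j k x
  le_repulsion : ∀ j k, j < k → ∀ x, x ≠ 0 → 1 / √(x ^ 2 + 4 * s) ≤ W j k x

/-- The condition `ν ≤ 2μ` enters here: the repulsion is at least `1/√(x² + 2ν)`, and `2ν ≤ 4μ ≤
4s`. For `ν = 0` the hypothesis only yields `W ≥ 0` at the origin, so `x ≠ 0` is required. -/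
theorem PotentialBounds.coulombBounds {μ ν : ℕ} {V : ι → ℝ → ℝ} {W : ι → ι → ℝ → ℝ}
    (h : PotentialBounds μ ν V W) (hνμ : ν ≤ 2 * μ) : CoulombBounds ((μ : ℝ) + 1) V W where
  measurable_attraction := h.1
  measurable_repulsion := h.2.1
  attraction_le j x := (h.2.2.1 j x).trans (regCoulomb_le μ x)
  repulsion_nonneg j k hjk x := (scaled_regCoulombPred_nonneg ν x).trans (h.2.2.2 j k hjk x)
  le_repulsion j k hjk x hx := by
    refine le_trans ?_ ((le_scaled_regCoulombPred ν x).trans (h.2.2.2 j k hjk x))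
    have h1 : (ν : ℝ) ≤ 2 * μ := by exact_mod_cast hνμ
    have h2 : 0 < x ^ 2 := by positivity
    apply one_div_le_one_div_of_le
    · positivity
    · exact Real.sqrt_le_sqrt (by linarith)

section Pairs

variable {s : ℝ} {V : ι → ℝ → ℝ} {W : ι → ι → ℝ → ℝ}

theorem CoulombBounds.attraction_le_three (h : CoulombBounds s V W) (hs : 1 ≤ s) (j : ι) (x : ℝ) :
    V j x ≤ 3 := by
  refine (h.attraction_le j x).trans ?_
  rw [div_le_iff₀ (by positivity)]
  have : 1 ≤ √(x ^ 2 + s) := Real.one_le_sqrt.2 (by nlinarith)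
  linarith

theorem CoulombBounds.attraction_le_mul (h : CoulombBounds s V W) (hs : 1 ≤ s) (j : ι) (x : ℝ) :
    V j x ≤ 3 * (1 / √(x ^ 2 + 1)) := by
  refine (h.attraction_le j x).trans ?_
  rw [mul_one_div]
  gcongr

theorem CoulombBounds.pairPotential_nonneg (h : CoulombBounds s V W) (j l : ι) (x : ι → ℝ) :
    0 ≤ pairPotential W j l x := by
  unfold pairPotential
  split_ifs with hjl
  · exact h.repulsion_nonneg j l hjl _
  · exact le_rfl

theorem CoulombBounds.measurable_pairPotential (h : CoulombBounds s V W) (j l : ι) :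
    Measurable (pairPotential W j l) := by
  unfold pairPotential
  by_cases hjl : j < l
  · simp only [if_pos hjl]
    exact (h.measurable_repulsion j l hjl).comp (by fun_prop)
  · simp only [if_neg hjl]
    exact measurable_const

end Pairs

variable [Fintype ι]

/-- The homogeneous form of the variational principle. Damped states and slices are not normalized,
and slices may vanish, so the zero case is included. -/
theorem mul_integral_sq_le_energy {Z M : ℝ} (hM : 0 < M) {V : ι → ℝ → ℝ} {W : ι → ι → ℝ → ℝ}
    {E : ℝ} (hE : (E : EReal) ≤ groundEnergy Z M V W) {Φ : (ι → ℝ) → ℂ} {g : ι → (ι → ℝ) → ℂ}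
    (h : HasSobolevGradient Φ g)
    (hint : Integrable (fun x => totalPotential Z V W x * ‖Φ x‖ ^ 2) volume) :
    E * ∫ x, ‖Φ x‖ ^ 2 ≤ 1 / M * (∑ i, ∫ x, ‖g i x‖ ^ 2) +
      ∫ x, totalPotential Z V W x * ‖Φ x‖ ^ 2 := by
  have hΦ2 : Integrable (fun x => ‖Φ x‖ ^ 2) volume :=
    h.1.integrable_norm_pow (p := 2) (by norm_num)
  have hI0 : 0 ≤ ∫ x, ‖Φ x‖ ^ 2 := integral_nonneg fun x => by positivity
  rcases hI0.eq_or_lt with hI | hI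
  · have h0 : (fun x => ‖Φ x‖ ^ 2) =ᵐ[volume] 0 :=
      (integral_eq_zero_iff_of_nonneg (fun x => by positivity) hΦ2).1 hI.symm
    have h1 : ∫ x, totalPotential Z V W x * ‖Φ x‖ ^ 2 = 0 := by
      rw [integral_eq_zero_of_ae]
      filter_upwards [h0] with x hx
      rw [hx]
      simp
    rw [← hI, h1, mul_zero, add_zero]
    exact mul_nonneg (by positivity) (Finset.sum_nonneg fun i _ =>
      integral_nonneg fun x => by positivity)
  · set n := ∫ x, ‖Φ x‖ ^ 2 with hn
    set c := (√n)⁻¹ with hc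
    have hc2 : c ^ 2 = n⁻¹ := by rw [hc, inv_pow, Real.sq_sqrt hI.le]
    have hsq : ∀ z : ℂ, ‖c • z‖ ^ 2 = n⁻¹ * ‖z‖ ^ 2 := fun z => by
      rw [norm_smul, mul_pow, Real.norm_eq_abs, sq_abs, hc2]
    have hmem : n⁻¹ * (1 / M * (∑ i, ∫ x, ‖g i x‖ ^ 2) +
        ∫ x, totalPotential Z V W x * ‖Φ x‖ ^ 2) ∈ energyValues Z M V W := by
      refine ⟨fun x => c • Φ x, fun i x => c • g i x, h.const_smul c, ?_, ?_, ?_⟩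
      · refine (hint.const_mul n⁻¹).congr (Eventually.of_forall fun x => ?_)
        simp only [hsq]
        ring
      · simp only [hsq]
        rw [integral_const_mul, ← hn, inv_mul_cancel₀ hI.ne']
      · simp only [hsq, mul_left_comm _ n⁻¹]
        simp only [integral_const_mul, ← Finset.mul_sum]
        ring
    have h2 : (E : EReal) ≤ ((n⁻¹ * (1 / M * (∑ i, ∫ x, ‖g i x‖ ^ 2) +
        ∫ x, totalPotential Z V W x * ‖Φ x‖ ^ 2) : ℝ) : EReal) :=
      hE.trans (iInf₂_le _ hmem)
    rw [EReal.coe_le_coe_iff, inv_mul_eq_div, le_div_iff₀ hI] at h2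
    exact h2

/-- The interaction of particle `k` with all the others. -/
def interactionWith (W : ι → ι → ℝ → ℝ) (k : ι) (x : ι → ℝ) : ℝ :=
  ∑ j, (pairPotential W k j x + pairPotential W j k x)

theorem totalPotential_eq (Z : ℝ) (V : ι → ℝ → ℝ) (W : ι → ι → ℝ → ℝ) (x : ι → ℝ) :
    totalPotential Z V W x = -Z * ∑ j, V j (x j) + ∑ j, ∑ l, pairPotential W j l x := by
  simp only [totalPotential, pairPotential, Finset.sum_filter]

theorem totalPotential_eq_remove (Z : ℝ) (V : ι → ℝ → ℝ) (W : ι → ι → ℝ → ℝ) (k : ι)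
    (x : ι → ℝ) :
    totalPotential Z V W x =
      totalPotential (ι := {j // j ≠ k}) Z (fun j => V j) (fun i j => W i j) (fun j => x j)
        - Z * V k (x k) + interactionWith W k x := by
  have hp : ∀ i j : {j // j ≠ k}, pairPotential (fun i j : {j // j ≠ k} => W i j) i j
      (fun j => x j) = pairPotential W i j x := fun i j => by
    simp [pairPotential]
  have hkk : pairPotential W k k x = 0 := by simp [pairPotential]
  simp only [totalPotential_eq, hp, interactionWith]
  rw [Fintype.sum_eq_add_sum_subtype_ne (fun j => V j (x j)) k,
    Fintype.sum_eq_add_sum_subtype_ne (fun j => ∑ l, pairPotential W j l x) k,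
    Fintype.sum_eq_add_sum_subtype_ne (fun j => pairPotential W k j x + pairPotential W j k x) k]
  simp only [fun j => Fintype.sum_eq_add_sum_subtype_ne (fun l => pairPotential W j l x) k,
    Finset.sum_add_distrib, hkk]
  ring

section Bounds

variable {s Z : ℝ} {V : ι → ℝ → ℝ} {W : ι → ι → ℝ → ℝ}

theorem CoulombBounds.interactionWith_nonneg (h : CoulombBounds s V W) (k : ι) (x : ι → ℝ) :
    0 ≤ interactionWith W k x :=
  Finset.sum_nonneg fun _ _ => add_nonneg (h.pairPotential_nonneg _ _ _)
    (h.pairPotential_nonneg _ _ _)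

theorem CoulombBounds.pairPotential_le (h : CoulombBounds s V W) (hs : 1 ≤ s) (hZ : 0 < Z)
    (j l : ι) (x : ι → ℝ) :
    pairPotential W j l x ≤ totalPotential Z V W x + 3 * Z * Fintype.card ι := by
  have h1 : ∑ j, V j (x j) ≤ 3 * Fintype.card ι := by
    refine (Finset.sum_le_sum fun j _ => h.attraction_le_three hs j (x j)).trans ?_
    simp [mul_comm]
  have h2 : pairPotential W j l x ≤ ∑ j, ∑ l, pairPotential W j l x :=
    (Finset.single_le_sum (f := fun l => pairPotential W j l x)
      (fun _ _ => h.pairPotential_nonneg _ _ _) (Finset.mem_univ l)).trans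
      (Finset.single_le_sum (f := fun j => ∑ l, pairPotential W j l x)
      (fun _ _ => Finset.sum_nonneg fun _ _ => h.pairPotential_nonneg _ _ _) (Finset.mem_univ j))
  rw [totalPotential_eq]
  nlinarith

theorem CoulombBounds.neg_le_totalPotential (h : CoulombBounds s V W) (hs : 1 ≤ s) (hZ : 0 < Z)
    (x : ι → ℝ) : -(3 * Z * Fintype.card ι) ≤ totalPotential Z V W x := by
  have h1 : ∑ j, V j (x j) ≤ 3 * Fintype.card ι := by
    refine (Finset.sum_le_sum fun j _ => h.attraction_le_three hs j (x j)).trans ?_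
    simp [mul_comm]
  have h2 : 0 ≤ ∑ j, ∑ l, pairPotential W j l x :=
    Finset.sum_nonneg fun _ _ => Finset.sum_nonneg fun _ _ => h.pairPotential_nonneg _ _ _
  rw [totalPotential_eq]
  nlinarith

theorem CoulombBounds.neg_attraction_le (h : CoulombBounds s V W) (hs : 1 ≤ s) (hZ : 0 < Z)
    (k : ι) (x : ι → ℝ) :
    -(Z * V k (x k)) ≤ totalPotential Z V W x + 3 * Z * Fintype.card ι := by
  have h1 : ∑ j, (3 - V j (x j)) = 3 * Fintype.card ι - ∑ j, V j (x j) := by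
    simp [mul_comm]
  have h3 : 3 - V k (x k) ≤ ∑ j, (3 - V j (x j)) :=
    Finset.single_le_sum (f := fun j => 3 - V j (x j))
      (fun j _ => by linarith [h.attraction_le_three hs j (x j)]) (Finset.mem_univ k)
  have h2 : 0 ≤ ∑ j, ∑ l, pairPotential W j l x :=
    Finset.sum_nonneg fun _ _ => Finset.sum_nonneg fun _ _ => h.pairPotential_nonneg _ _ _
  rw [totalPotential_eq]
  nlinarith

/-- Finite energy is assumed only for the total potential. Every single attraction or pair term is
bounded below by a constant and above by the total potential plus a constant, which makes it
integrable too. -/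
theorem integrable_mul_of_between {α : Type*} [MeasurableSpace α] {m : Measure α} {f P ρ : α → ℝ}
    {C D : ℝ} (hf : AEStronglyMeasurable f m) (hρ : Integrable ρ m) (hρ0 : ∀ x, 0 ≤ ρ x)
    (hP : Integrable (fun x => P x * ρ x) m) (h1 : ∀ x, -C ≤ f x) (h2 : ∀ x, f x ≤ P x + D) :
    Integrable (fun x => f x * ρ x) m := by
  refine Integrable.mono' ((hP.add (hρ.const_mul D)).add (hρ.const_mul (2 * |C|)))
    (hf.mul hρ.1) (Eventually.of_forall fun x => ?_)
  have h3 := mul_le_mul_of_nonneg_right (h1 x) (hρ0 x)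
  have h4 := mul_le_mul_of_nonneg_right (h2 x) (hρ0 x)
  have h5 := mul_le_mul_of_nonneg_right (le_abs_self C) (hρ0 x)
  have h6 := mul_nonneg (abs_nonneg C) (hρ0 x)
  simp only [Pi.add_apply, Real.norm_eq_abs]
  rw [abs_le]
  constructor <;> nlinarith

variable {Φ : (ι → ℝ) → ℂ}

theorem CoulombBounds.integrable_pairPotential (h : CoulombBounds s V W) (hs : 1 ≤ s) (hZ : 0 < Z)
    (hΦ : MemLp Φ 2 volume)
    (hint : Integrable (fun x => totalPotential Z V W x * ‖Φ x‖ ^ 2) volume) (j l : ι) :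
    Integrable (fun x => pairPotential W j l x * ‖Φ x‖ ^ 2) volume :=
  integrable_mul_of_between (C := 0) (h.measurable_pairPotential j l).aestronglyMeasurable
    (hΦ.integrable_norm_pow (p := 2) (by norm_num)) (fun x => by positivity) hint
    (fun x => by simpa using h.pairPotential_nonneg j l x) (fun x => h.pairPotential_le hs hZ j l x)

theorem CoulombBounds.integrable_interactionWith (h : CoulombBounds s V W) (hs : 1 ≤ s)
    (hZ : 0 < Z) (hΦ : MemLp Φ 2 volume)
    (hint : Integrable (fun x => totalPotential Z V W x * ‖Φ x‖ ^ 2) volume) (k : ι) :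
    Integrable (fun x => interactionWith W k x * ‖Φ x‖ ^ 2) volume := by
  simp only [interactionWith, Finset.sum_mul, add_mul]
  exact integrable_finsetSum _ fun j _ => (h.integrable_pairPotential hs hZ hΦ hint k j).add
    (h.integrable_pairPotential hs hZ hΦ hint j k)

theorem CoulombBounds.integrable_attraction (h : CoulombBounds s V W) (hs : 1 ≤ s)
    (hZ : 0 < Z) (hΦ : MemLp Φ 2 volume)
    (hint : Integrable (fun x => totalPotential Z V W x * ‖Φ x‖ ^ 2) volume) (k : ι) :
    Integrable (fun x => Z * V k (x k) * ‖Φ x‖ ^ 2) volume := by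
  have hm : Measurable fun x : ι → ℝ => -(Z * V k (x k)) :=
    (((h.measurable_attraction k).comp (measurable_pi_apply k)).const_mul Z).neg
  have h1 := (integrable_mul_of_between (C := 3 * Z) hm.aestronglyMeasurable
    (hΦ.integrable_norm_pow (p := 2) (by norm_num)) (fun x => by positivity) hint
    (fun x => by nlinarith [h.attraction_le_three hs k (x k)])
    (fun x => h.neg_attraction_le hs hZ k x)).neg
  refine h1.congr (Eventually.of_forall fun x => ?_)
  simp

theorem CoulombBounds.integrable_remove (h : CoulombBounds s V W) (hs : 1 ≤ s)
    (hZ : 0 < Z) (hΦ : MemLp Φ 2 volume)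
    (hint : Integrable (fun x => totalPotential Z V W x * ‖Φ x‖ ^ 2) volume) (k : ι) :
    Integrable (fun x => totalPotential (ι := {j // j ≠ k}) Z (fun j => V j) (fun i j => W i j)
      (fun j => x j) * ‖Φ x‖ ^ 2) volume := by
  refine ((hint.add (h.integrable_attraction hs hZ hΦ hint k)).sub
    (h.integrable_interactionWith hs hZ hΦ hint k)).congr (Eventually.of_forall fun x => ?_)
  simp only [Pi.add_apply, Pi.sub_apply, totalPotential_eq_remove Z V W k x]
  ring

end Bounds

end Energy

/-! ### The expectation of `1 / √(x_k² + 1)` -/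

section Ionization

variable {ι : Type*} [Fintype ι] [LinearOrder ι]

/-- The expectation of `1 / √(x_k² + 1)` is controlled by the kinetic energy in `x_k`, up to a
logarithm of the cutoff length `L`. -/
theorem HasSobolevGradient.integral_inv_sqrt_le {Φ : (ι → ℝ) → ℂ} {g : ι → (ι → ℝ) → ℂ}
    (h : HasSobolevGradient Φ g) (k : ι) {L δ : ℝ} (hL : 1 ≤ L) (hδ : 0 < δ) :
    ∫ x, 1 / √(x k ^ 2 + 1) * ‖Φ x‖ ^ 2 ≤
      δ * (∫ x, ‖g k x‖ ^ 2) + (Real.log L ^ 2 / δ + 1 / L) * ∫ x, ‖Φ x‖ ^ 2 := by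
  have hL0 : 0 < L := by linarith
  have hlog : 0 ≤ Real.log L := Real.log_nonneg hL
  set C := max 1 (Real.log L)
  have hΦ2 : Integrable (fun x => ‖Φ x‖ ^ 2) volume :=
    h.1.integrable_norm_pow (p := 2) (by norm_num)
  have hg2 : Integrable (fun x => ‖g k x‖ ^ 2) volume :=
    (h.2.1 k).integrable_norm_pow (p := 2) (by norm_num)
  have hC : ∀ x, |logPrimitive L x| ≤ C := fun x =>
    (abs_logPrimitive_le hL x).trans (le_max_right _ _)
  have hD : ∀ x, |1 / √(x ^ 2 + 1) - 1 / √(x ^ 2 + L ^ 2)| ≤ C := fun x =>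
    (abs_logPrimitive_deriv_le x hL).trans (le_max_left _ _)
  have hibp := h.integral_deriv_mul_sq k contDiff_logPrimitive (hasDerivAt_logPrimitive hL0) hC hD
  have hi1 : Integrable (fun x : ι → ℝ => (1 / √(x k ^ 2 + 1) - 1 / √(x k ^ 2 + L ^ 2)) *
      ‖Φ x‖ ^ 2) volume :=
    integrable_bdd_mul_sq h.1 (Measurable.aestronglyMeasurable (by fun_prop)) (fun x => hD (x k))
  have hi2 : Integrable (fun x : ι → ℝ => logPrimitive L (x k) * inner ℝ (Φ x) (g k x)) volume :=
    integrable_bdd_mul_inner h.1 (h.2.1 k) ((contDiff_logPrimitive.continuous.comp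
      (continuous_apply k)).aestronglyMeasurable) (fun x => hC (x k))
  have hi3 : Integrable (fun x : ι → ℝ => 1 / √(x k ^ 2 + 1) * ‖Φ x‖ ^ 2) volume := by
    refine integrable_bdd_mul_sq (C := 1) h.1 (Measurable.aestronglyMeasurable (by fun_prop))
      (fun x => ?_)
    rw [abs_of_nonneg (by positivity), div_le_one (by positivity)]
    exact Real.one_le_sqrt.2 (by nlinarith)
  have h1 : ∫ x : ι → ℝ, 1 / √(x k ^ 2 + 1) * ‖Φ x‖ ^ 2 ≤
      ∫ x : ι → ℝ, ((1 / √(x k ^ 2 + 1) - 1 / √(x k ^ 2 + L ^ 2)) * ‖Φ x‖ ^ 2 +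
        1 / L * ‖Φ x‖ ^ 2) := by
    refine integral_mono hi3 (hi1.add (hΦ2.const_mul _)) fun x => ?_
    have h2 : 1 / √(x k ^ 2 + L ^ 2) ≤ 1 / L := by
      apply one_div_le_one_div_of_le hL0
      exact Real.le_sqrt_of_sq_le (by nlinarith [sq_nonneg (x k)])
    have h3 := mul_le_mul_of_nonneg_right h2 (sq_nonneg ‖Φ x‖)
    simp only
    linarith
  -- The boundary-free term of the integration by parts is split by Young's inequality with
  -- parameter `δ`.
  have h4 : ∫ x : ι → ℝ, (-2) * (logPrimitive L (x k) * inner ℝ (Φ x) (g k x)) ≤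
      ∫ x, (δ * ‖g k x‖ ^ 2 + Real.log L ^ 2 / δ * ‖Φ x‖ ^ 2) := by
    refine integral_mono (hi2.const_mul _) ((hg2.const_mul _).add (hΦ2.const_mul _)) fun x => ?_
    have h5 : |logPrimitive L (x k) * inner ℝ (Φ x) (g k x)| ≤
        Real.log L * (‖Φ x‖ * ‖g k x‖) := by
      rw [abs_mul]
      exact mul_le_mul (abs_logPrimitive_le hL _) (abs_real_inner_le_norm _ _) (abs_nonneg _) hlog
    have h6 : 0 ≤ (δ * ‖g k x‖ - Real.log L * ‖Φ x‖) ^ 2 / δ := by positivity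
    have h7 : (δ * ‖g k x‖ - Real.log L * ‖Φ x‖) ^ 2 / δ = δ * ‖g k x‖ ^ 2
        - 2 * (Real.log L * (‖Φ x‖ * ‖g k x‖)) + Real.log L ^ 2 / δ * ‖Φ x‖ ^ 2 := by
      field_simp
      ring
    simp only
    linarith [neg_abs_le (logPrimitive L (x k) * inner ℝ (Φ x) (g k x))]
  rw [integral_add hi1 (hΦ2.const_mul _), hibp, integral_const_mul] at h1
  rw [integral_add (hg2.const_mul _) (hΦ2.const_mul _), integral_const_mul, integral_const_mul,
    integral_const_mul] at h4
  linarith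

section

variable {s Z M : ℝ} {V : ι → ℝ → ℝ} {W : ι → ι → ℝ → ℝ} {Φ : (ι → ℝ) → ℂ}
  {g : ι → (ι → ℝ) → ℂ}

/-- If the system without particle `k` has energy at least `E`, then so does, after averaging
against a weight depending on `x_k`, the part of the full Hamiltonian which does not involve
`x_k`. -/
theorem CoulombBounds.weighted_lower_bound (h : CoulombBounds s V W) (hs : 1 ≤ s) (hZ : 0 < Z)
    (hM : 0 < M) {k : ι} {E : ℝ} (hE : (E : EReal) ≤ groundEnergyRemove Z M V W k)
    (hΦ : HasSobolevGradient Φ g)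
    (hint : Integrable (fun x => totalPotential Z V W x * ‖Φ x‖ ^ 2) volume)
    {F : ℝ → ℝ} (hFm : Measurable F) (hF0 : ∀ x, 0 ≤ F x) {C : ℝ} (hFC : ∀ x, |F x| ≤ C) :
    0 ≤ ∫ x, F (x k) * (1 / M * (∑ i : {i // i ≠ k}, ‖g i x‖ ^ 2) +
      totalPotential Z V W x * ‖Φ x‖ ^ 2 + Z * V k (x k) * ‖Φ x‖ ^ 2
      - interactionWith W k x * ‖Φ x‖ ^ 2 - E * ‖Φ x‖ ^ 2) := by
  have h1 := weighted_lower_bound_of_slices k (c := 1 / M) (E := E)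
    (U := totalPotential (ι := {j // j ≠ k}) Z (fun j => V j) (fun i j => W i j))
    (fun χ γ hχ hi => mul_integral_sq_le_energy hM hE hχ hi) hΦ
    (h.integrable_remove hs hZ hΦ.1 hint k) hFm hF0 hFC
  refine h1.trans_eq (integral_congr_ae (Eventually.of_forall fun x => ?_))
  simp only [totalPotential_eq_remove Z V W k x]
  ring

theorem CoulombBounds.integral_inv_sqrt_le (h : CoulombBounds s V W) (hs : 1 ≤ s) (hZ : 0 < Z)
    (hM : 0 < M) {k : ι} {E : ℝ} (hE : (E : EReal) ≤ groundEnergyRemove Z M V W k)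
    (hΦ : HasSobolevGradient Φ g)
    (hint : Integrable (fun x => totalPotential Z V W x * ‖Φ x‖ ^ 2) volume)
    (hnorm : ∫ x, ‖Φ x‖ ^ 2 = 1)
    (hle : 1 / M * (∑ i, ∫ x, ‖g i x‖ ^ 2) + (∫ x, totalPotential Z V W x * ‖Φ x‖ ^ 2) ≤ E)
    {L : ℝ} (hL : 1 ≤ L) :
    ∫ x, 1 / √(x k ^ 2 + 1) * ‖Φ x‖ ^ 2 ≤ 12 * Z * M * Real.log L ^ 2 + 2 / L := by
  have hΦ2 : Integrable (fun x => ‖Φ x‖ ^ 2) volume :=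
    hΦ.1.integrable_norm_pow (p := 2) (by norm_num)
  have hg2 : ∀ i, Integrable (fun x => ‖g i x‖ ^ 2) volume := fun i =>
    (hΦ.2.1 i).integrable_norm_pow (p := 2) (by norm_num)
  have hU : Integrable (fun x : ι → ℝ => 1 / √(x k ^ 2 + 1) * ‖Φ x‖ ^ 2) volume := by
    refine integrable_bdd_mul_sq (C := 1) hΦ.1 (Measurable.aestronglyMeasurable (by fun_prop))
      (fun x => ?_)
    rw [abs_of_nonneg (by positivity), div_le_one (by positivity)]
    exact Real.one_le_sqrt.2 (by nlinarith)
  have hV := h.integrable_attraction hs hZ hΦ.1 hint k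
  have hR := h.integrable_interactionWith hs hZ hΦ.1 hint k
  have hG : Integrable (fun x => 1 / M * ∑ i : {i // i ≠ k}, ‖g i x‖ ^ 2) volume :=
    (integrable_finsetSum _ fun (i : {i // i ≠ k}) _ => hg2 i).const_mul _
  have hl := h.weighted_lower_bound hs hZ hM hE hΦ hint (F := fun _ => 1) measurable_const
    (by simp) (C := 1) (by simp)
  have hA : Integrable (fun x => 1 / M * (∑ i : {i // i ≠ k}, ‖g i x‖ ^ 2) +
      totalPotential Z V W x * ‖Φ x‖ ^ 2) volume := hG.add hint
  have hB : Integrable (fun x => 3 * Z * (1 / √(x k ^ 2 + 1) * ‖Φ x‖ ^ 2) - E * ‖Φ x‖ ^ 2)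
    volume := (hU.const_mul _).sub (hΦ2.const_mul _)
  have h1 : 0 ≤ ∫ x, ((1 / M * (∑ i : {i // i ≠ k}, ‖g i x‖ ^ 2) +
      totalPotential Z V W x * ‖Φ x‖ ^ 2) +
      (3 * Z * (1 / √(x k ^ 2 + 1) * ‖Φ x‖ ^ 2) - E * ‖Φ x‖ ^ 2)) := by
    refine hl.trans (integral_mono ?_ (hA.add hB) fun x => ?_)
    · simp only [one_mul]
      exact ((hA.add hV).sub hR).sub (hΦ2.const_mul _)
    · have h2 := mul_nonneg (h.interactionWith_nonneg k x) (sq_nonneg ‖Φ x‖)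
      have h3 := mul_le_mul_of_nonneg_right (mul_le_mul_of_nonneg_left
        (h.attraction_le_mul hs k (x k)) hZ.le) (sq_nonneg ‖Φ x‖)
      linarith
  rw [integral_add hA hB, integral_add hG hint, integral_sub (hU.const_mul _) (hΦ2.const_mul _),
    integral_const_mul, integral_const_mul, integral_const_mul, hnorm,
    integral_finsetSum _ fun (i : {i // i ≠ k}) _ => hg2 i] at h1
  rw [Fintype.sum_eq_add_sum_subtype_ne (fun i => ∫ x, ‖g i x‖ ^ 2) k, mul_add] at hle
  set T := ∫ x, ‖g k x‖ ^ 2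
  set U := ∫ x : ι → ℝ, 1 / √(x k ^ 2 + 1) * ‖Φ x‖ ^ 2
  -- Since the total energy is at most `E`, while the part without `x_k` contributes at least `E`,
  -- the kinetic energy in `x_k` cannot exceed the attraction.
  have hT : 1 / M * T ≤ 3 * Z * U := by linarith
  -- This `δ` makes the kinetic term at most `U / 2`, which is absorbed on the left.
  have h4 := hΦ.integral_inv_sqrt_le k hL (δ := 1 / (6 * Z * M)) (by positivity)
  rw [hnorm, mul_one] at h4
  have h5 : 1 / (6 * Z * M) * T ≤ U / 2 := by
    have : 1 / (6 * Z * M) * T = 1 / (6 * Z) * (1 / M * T) := by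
      field_simp
    rw [this]
    calc 1 / (6 * Z) * (1 / M * T) ≤ 1 / (6 * Z) * (3 * Z * U) := by gcongr
      _ = U / 2 := by
        field_simp
        ring
  have h6 : Real.log L ^ 2 / (1 / (6 * Z * M)) = 6 * Z * M * Real.log L ^ 2 := by
    field_simp
  have h7 : 2 / L = 2 * (1 / L) := by ring
  rw [h6] at h4
  change U ≤ _ at h4
  rw [h7]
  linarith

end

end Ionization

/-! ### First variation of the energy under damping -/

section Variation

variable {ι : Type*} [Fintype ι] [LinearOrder ι]
variable {s Z M : ℝ} {V : ι → ℝ → ℝ} {W : ι → ι → ℝ → ℝ} {Φ : (ι → ℝ) → ℂ}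
  {g : ι → (ι → ℝ) → ℂ}

theorem abs_weight_le {ε : ℝ} (hε : 0 < ε) (hs : 0 < s) (x : ℝ) : |weight ε s x| ≤ ε⁻¹ := by
  rw [abs_of_pos (weight_pos hε hs x)]
  exact weight_le_inv hε hs x

/-- Pointwise estimate of the energy density of a damped state. -/
theorem damped_kinetic_le {ε t : ℝ} (hε : 0 < ε) (hs : 1 ≤ s) (ht : 0 ≤ t) (htε : 2 * t ≤ ε)
    (y : ℝ) (φ γ : ℂ) :
    ‖damping t ε s y • γ + (-(t * weightDeriv ε s y) / (2 * damping t ε s y)) • φ‖ ^ 2 ≤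
      ‖γ‖ ^ 2 + t / 4 * (1 / √(y ^ 2 + 1) * ‖φ‖ ^ 2) + t ^ 2 * ‖φ‖ ^ 2 := by
  have hs0 : 0 < s := by linarith
  have hf := damping_pos hε hs0 ht htε y
  set f := damping t ε s y with hfd
  set w := weight ε s y with hwd
  set w' := weightDeriv ε s y with hwd'
  set f' := -(t * w') / (2 * f) with hfd'
  have hf2 : f ^ 2 = 1 - t * w := sq_damping hε hs0 ht htε y
  have hw : 0 < w := weight_pos hε hs0 y
  have hff' : 2 * (f * f') = -(t * w') := by
    rw [hfd']
    field_simp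
  have hf'2 : f' ^ 2 ≤ t ^ 2 := sq_damping_deriv_le hε hs0 ht htε y
  have hw'2 : w' ^ 2 ≤ w * (1 / √(y ^ 2 + 1)) := sq_weightDeriv_le hε hs y
  have hexp : ‖f • γ + f' • φ‖ ^ 2 =
      f ^ 2 * ‖γ‖ ^ 2 + 2 * (f * f') * inner ℝ φ γ + f' ^ 2 * ‖φ‖ ^ 2 := by
    rw [norm_add_sq_real, norm_smul, norm_smul, mul_pow, mul_pow, real_inner_smul_left,
      real_inner_smul_right, Real.norm_eq_abs, Real.norm_eq_abs, sq_abs, sq_abs,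
      real_inner_comm]
    ring
  have h1 : |w' * inner ℝ φ γ| ≤ |w'| * (‖φ‖ * ‖γ‖) := by
    rw [abs_mul]
    exact mul_le_mul_of_nonneg_left (abs_real_inner_le_norm _ _) (abs_nonneg _)
  -- The term `w ‖γ‖²` produced here is exactly compensated by the loss `-t w ‖γ‖²` in `f² ‖γ‖²`;
  -- only the localization error `w'²/(4w)` remains.
  have h2 : |w'| * (‖φ‖ * ‖γ‖) ≤ w * ‖γ‖ ^ 2 + 1 / 4 * (1 / √(y ^ 2 + 1) * ‖φ‖ ^ 2) := by
    have h3 : 0 ≤ (2 * w * ‖γ‖ - |w'| * ‖φ‖) ^ 2 / (4 * w) := by positivity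
    have h4 : (2 * w * ‖γ‖ - |w'| * ‖φ‖) ^ 2 / (4 * w) =
        w * ‖γ‖ ^ 2 - |w'| * (‖φ‖ * ‖γ‖) + 1 / 4 * (w' ^ 2 / w * ‖φ‖ ^ 2) := by
      rw [← sq_abs w']
      field_simp
      ring
    have h5 : w' ^ 2 / w ≤ 1 / √(y ^ 2 + 1) := by
      rw [div_le_iff₀ hw]
      linarith
    have h6 := mul_le_mul_of_nonneg_right h5 (sq_nonneg ‖φ‖)
    linarith
  have h7 := mul_le_mul_of_nonneg_right hf'2 (sq_nonneg ‖φ‖)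
  have h8 : -(w * ‖γ‖ ^ 2 + 1 / 4 * (1 / √(y ^ 2 + 1) * ‖φ‖ ^ 2)) ≤ w' * inner ℝ φ γ := by
    linarith [neg_abs_le (w' * inner ℝ φ γ)]
  have h9 := mul_le_mul_of_nonneg_left h8 ht
  rw [hexp, hff', hf2]
  linarith

/-- The energy of an approximate ground state, tested against a bounded weight in `x_k`. -/
theorem weighted_energy_le (hs : 1 ≤ s)
    (hM : 0 < M) (k : ι) {E : ℝ} (hE : (E : EReal) ≤ groundEnergy Z M V W)
    (hΦ : HasSobolevGradient Φ g)
    (hint : Integrable (fun x => totalPotential Z V W x * ‖Φ x‖ ^ 2) volume)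
    (hnorm : ∫ x, ‖Φ x‖ ^ 2 = 1) {ε t : ℝ} (hε : 0 < ε) (ht : 0 < t) (htε : 2 * t ≤ ε)
    (hle : 1 / M * (∑ i, ∫ x, ‖g i x‖ ^ 2) + (∫ x, totalPotential Z V W x * ‖Φ x‖ ^ 2) ≤
      E + t / 2) :
    (∫ x, weight ε s (x k) * (1 / M * (∑ i : {i // i ≠ k}, ‖g i x‖ ^ 2) +
        totalPotential Z V W x * ‖Φ x‖ ^ 2)) ≤
      E * (∫ x, weight ε s (x k) * ‖Φ x‖ ^ 2) +
        1 / (4 * M) * (∫ x, 1 / √(x k ^ 2 + 1) * ‖Φ x‖ ^ 2) + t / M + 1 / 2 := by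
  have hs0 : 0 < s := by linarith
  have hΦ2 : Integrable (fun x => ‖Φ x‖ ^ 2) volume :=
    hΦ.1.integrable_norm_pow (p := 2) (by norm_num)
  have hg2 : ∀ i, Integrable (fun x => ‖g i x‖ ^ 2) volume := fun i =>
    (hΦ.2.1 i).integrable_norm_pow (p := 2) (by norm_num)
  have hU : Integrable (fun x : ι → ℝ => 1 / √(x k ^ 2 + 1) * ‖Φ x‖ ^ 2) volume := by
    refine integrable_bdd_mul_sq (C := 1) hΦ.1 (Measurable.aestronglyMeasurable (by fun_prop))
      (fun x => ?_)
    rw [abs_of_nonneg (by positivity), div_le_one (by positivity)]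
    exact Real.one_le_sqrt.2 (by nlinarith)
  have hwm : AEStronglyMeasurable (fun x : ι → ℝ => weight ε s (x k)) volume :=
    ((contDiff_weight hε hs0).continuous.comp (continuous_apply k)).aestronglyMeasurable
  have hfm : AEStronglyMeasurable (fun x : ι → ℝ => damping t ε s (x k)) volume :=
    ((contDiff_damping hε hs0 ht.le htε).continuous.comp (continuous_apply k)).aestronglyMeasurable
  have hwΦ : Integrable (fun x => weight ε s (x k) * ‖Φ x‖ ^ 2) volume :=
    integrable_bdd_mul_sq hΦ.1 hwm (fun x => abs_weight_le hε hs0 _)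
  have hG : Integrable (fun x => 1 / M * (∑ i : {i // i ≠ k}, ‖g i x‖ ^ 2) +
      totalPotential Z V W x * ‖Φ x‖ ^ 2) volume :=
    ((integrable_finsetSum _ fun (i : {i // i ≠ k}) _ => hg2 i).const_mul _).add hint
  have hwG : Integrable (fun x => weight ε s (x k) * (1 / M * (∑ i : {i // i ≠ k}, ‖g i x‖ ^ 2) +
      totalPotential Z V W x * ‖Φ x‖ ^ 2)) volume :=
    hG.bdd_mul hwm (Eventually.of_forall fun x => abs_weight_le hε hs0 _)
  set f' : ℝ → ℝ := fun y => -(t * weightDeriv ε s y) / (2 * damping t ε s y) with hf'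
  have hbf : ∀ y, |damping t ε s y| ≤ max 1 t := fun y =>
    (abs_damping_le_one hε hs0 ht.le y).trans (le_max_left _ _)
  have hbf' : ∀ y, |f' y| ≤ max 1 t := fun y =>
    (abs_le_of_sq_le_sq (sq_damping_deriv_le hε hs0 ht.le htε y) ht.le).trans (le_max_right _ _)
  have hΨ := hΦ.smul_coord k (contDiff_damping hε hs0 ht.le htε)
    (hasDerivAt_damping hε hs0 ht.le htε) hbf hbf'
  have hΨ2 : ∀ x, ‖damping t ε s (x k) • Φ x‖ ^ 2 =
      ‖Φ x‖ ^ 2 - t * (weight ε s (x k) * ‖Φ x‖ ^ 2) := fun x => by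
    rw [norm_smul, mul_pow, Real.norm_eq_abs, sq_abs, sq_damping hε hs0 ht.le htε]
    ring
  have hPw : Integrable (fun x => weight ε s (x k) * (totalPotential Z V W x * ‖Φ x‖ ^ 2))
      volume := hint.bdd_mul hwm (Eventually.of_forall fun x => abs_weight_le hε hs0 _)
  have hΨpot : Integrable (fun x => totalPotential Z V W x * ‖damping t ε s (x k) • Φ x‖ ^ 2)
      volume := by
    refine (hint.sub (hPw.const_mul t)).congr (Eventually.of_forall fun x => ?_)
    simp only [hΨ2, Pi.sub_apply]
    ring
  have hlow := mul_integral_sq_le_energy hM hE hΨ hΨpot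
  have hΨg2 : ∀ i, Integrable (fun x => ‖damping t ε s (x k) • g i x +
      (if i = k then f' (x k) else 0) • Φ x‖ ^ 2) volume := fun i =>
    (hΨ.2.1 i).integrable_norm_pow (p := 2) (by norm_num)
  have hK : Integrable (fun x => 1 / M * ∑ i, ‖damping t ε s (x k) • g i x +
      (if i = k then f' (x k) else 0) • Φ x‖ ^ 2) volume :=
    (integrable_finsetSum _ fun i _ => hΨg2 i).const_mul _
  have hK0 : Integrable (fun x => 1 / M * ∑ i, ‖g i x‖ ^ 2) volume :=
    (integrable_finsetSum _ fun i _ => hg2 i).const_mul _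
  have hE0 : Integrable (fun x => 1 / M * (∑ i, ‖g i x‖ ^ 2) +
      totalPotential Z V W x * ‖Φ x‖ ^ 2) volume := hK0.add hint
  have hE1 : Integrable (fun x => 1 / M * (∑ i, ‖g i x‖ ^ 2) +
      totalPotential Z V W x * ‖Φ x‖ ^ 2 - t * (weight ε s (x k) *
      (1 / M * (∑ i : {i // i ≠ k}, ‖g i x‖ ^ 2) + totalPotential Z V W x * ‖Φ x‖ ^ 2)))
      volume := hE0.sub (hwG.const_mul t)
  have hE2 : Integrable (fun x => t / (4 * M) * (1 / √(x k ^ 2 + 1) * ‖Φ x‖ ^ 2) +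
      t ^ 2 / M * ‖Φ x‖ ^ 2) volume := (hU.const_mul _).add (hΦ2.const_mul _)
  have hmono : ∫ x, (1 / M * (∑ i, ‖damping t ε s (x k) • g i x +
      (if i = k then f' (x k) else 0) • Φ x‖ ^ 2) +
      totalPotential Z V W x * ‖damping t ε s (x k) • Φ x‖ ^ 2) ≤
      ∫ x, ((1 / M * (∑ i, ‖g i x‖ ^ 2) +
      totalPotential Z V W x * ‖Φ x‖ ^ 2 - t * (weight ε s (x k) *
      (1 / M * (∑ i : {i // i ≠ k}, ‖g i x‖ ^ 2) + totalPotential Z V W x * ‖Φ x‖ ^ 2))) +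
      (t / (4 * M) * (1 / √(x k ^ 2 + 1) * ‖Φ x‖ ^ 2) + t ^ 2 / M * ‖Φ x‖ ^ 2)) := by
    refine integral_mono (hK.add hΨpot) (hE1.add hE2) fun x => ?_
    have h1 := damped_kinetic_le hε hs ht.le htε (x k) (Φ x) (g k x)
    have h2 : ∀ i : {i // i ≠ k}, ‖damping t ε s (x k) • g i x +
        (if (i : ι) = k then f' (x k) else 0) • Φ x‖ ^ 2 =
        (1 - t * weight ε s (x k)) * ‖g i x‖ ^ 2 := fun i => by
      rw [if_neg i.2, zero_smul, add_zero, norm_smul, mul_pow, Real.norm_eq_abs, sq_abs,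
        sq_damping hε hs0 ht.le htε]
    have h3 := mul_le_mul_of_nonneg_left h1 (one_div_pos.2 hM).le
    simp only
    rw [Fintype.sum_eq_add_sum_subtype_ne (fun i => ‖damping t ε s (x k) • g i x +
      (if i = k then f' (x k) else 0) • Φ x‖ ^ 2) k,
      Fintype.sum_eq_add_sum_subtype_ne (fun i => ‖g i x‖ ^ 2) k, hΨ2, if_pos rfl]
    simp only [h2, ← Finset.mul_sum]
    have h4 : t / (4 * M) * (1 / √(x k ^ 2 + 1) * ‖Φ x‖ ^ 2) =
      1 / M * (t / 4 * (1 / √(x k ^ 2 + 1) * ‖Φ x‖ ^ 2)) := by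
      field_simp
    have h5 : t ^ 2 / M * ‖Φ x‖ ^ 2 = 1 / M * (t ^ 2 * ‖Φ x‖ ^ 2) := by
      field_simp
    rw [h4, h5]
    simp only [hf']
    linarith
  rw [integral_add hK hΨpot, integral_const_mul, integral_finsetSum _ fun i _ => hΨg2 i,
    integral_add hE1 hE2, integral_sub hE0 (hwG.const_mul t), integral_add hK0 hint,
    integral_add (hU.const_mul _) (hΦ2.const_mul _), integral_const_mul, integral_const_mul,
    integral_const_mul, integral_const_mul, hnorm, integral_finsetSum _ fun i _ => hg2 i] at hmono
  simp only [hΨ2] at hlow hmono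
  rw [integral_sub hΦ2 (hwΦ.const_mul t), integral_const_mul, hnorm] at hlow
  -- The zeroth-order terms `E` cancel, so dividing by `t` leaves the first variation. The energy
  -- excess `t / 2` becomes the constant `1 / 2`.
  have hfin := hlow.trans hmono
  set A := ∫ x, weight ε s (x k) * (1 / M * (∑ i : {i // i ≠ k}, ‖g i x‖ ^ 2) +
        totalPotential Z V W x * ‖Φ x‖ ^ 2)
  set w := ∫ x, weight ε s (x k) * ‖Φ x‖ ^ 2
  set u := ∫ x : ι → ℝ, 1 / √(x k ^ 2 + 1) * ‖Φ x‖ ^ 2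
  have hfin2 : t * A ≤ t * (E * w + 1 / (4 * M) * u + t / M + 1 / 2) := by
    have e1 : t / (4 * M) * u = t * (1 / (4 * M) * u) := by ring
    have e2 : t ^ 2 / M * 1 = t * (t / M) := by ring
    rw [e1, e2] at hfin
    linarith
  exact le_of_mul_le_mul_left hfin2 ht

/-- Each electron of an approximate ground state: the weighted repulsion by the others is at most
the weighted attraction, up to localization errors. -/
theorem CoulombBounds.weighted_repulsion_le (h : CoulombBounds s V W) (hs : 1 ≤ s) (hZ : 0 < Z)
    (hM : 0 < M) (k : ι) {E E' : ℝ} (hE : (E : EReal) ≤ groundEnergy Z M V W)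
    (hE' : (E' : EReal) ≤ groundEnergyRemove Z M V W k)
    (hΦ : HasSobolevGradient Φ g)
    (hint : Integrable (fun x => totalPotential Z V W x * ‖Φ x‖ ^ 2) volume)
    (hnorm : ∫ x, ‖Φ x‖ ^ 2 = 1) {ε t : ℝ} (hε : 0 < ε) (ht : 0 < t) (htε : 2 * t ≤ ε)
    (htM : 2 * t ≤ M) (htE : E + t / 2 ≤ E')
    (hle : 1 / M * (∑ i, ∫ x, ‖g i x‖ ^ 2) + (∫ x, totalPotential Z V W x * ‖Φ x‖ ^ 2) ≤
      E + t / 2) {L : ℝ} (hL : 1 ≤ L) :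
    (E' - E) * (∫ x, weight ε s (x k) * ‖Φ x‖ ^ 2) +
        (∫ x, weight ε s (x k) * (interactionWith W k x * ‖Φ x‖ ^ 2)) ≤
      3 * Z + 3 * Z * Real.log L ^ 2 + 1 / (2 * L * M) + 1 := by
  have hs0 : 0 < s := by linarith
  have hL0 : 0 < L := by linarith
  have hΦ2 : Integrable (fun x => ‖Φ x‖ ^ 2) volume :=
    hΦ.1.integrable_norm_pow (p := 2) (by norm_num)
  have hg2 : ∀ i, Integrable (fun x => ‖g i x‖ ^ 2) volume := fun i =>
    (hΦ.2.1 i).integrable_norm_pow (p := 2) (by norm_num)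
  have hwc := (contDiff_weight hε hs0).continuous
  have hwm : AEStronglyMeasurable (fun x : ι → ℝ => weight ε s (x k)) volume :=
    (hwc.comp (continuous_apply k)).aestronglyMeasurable
  have hbdd : ∀ {u : (ι → ℝ) → ℝ}, Integrable u volume →
      Integrable (fun x => weight ε s (x k) * u x) volume := fun hu =>
    hu.bdd_mul hwm (Eventually.of_forall fun x => abs_weight_le hε hs0 _)
  have hG : Integrable (fun x => 1 / M * (∑ i : {i // i ≠ k}, ‖g i x‖ ^ 2) +
      totalPotential Z V W x * ‖Φ x‖ ^ 2) volume :=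
    ((integrable_finsetSum _ fun (i : {i // i ≠ k}) _ => hg2 i).const_mul _).add hint
  have hV := h.integrable_attraction hs hZ hΦ.1 hint k
  have hR := h.integrable_interactionWith hs hZ hΦ.1 hint k
  have hslice := h.weighted_lower_bound hs hZ hM hE' hΦ hint hwc.measurable
    (fun x => (weight_pos hε hs0 x).le) (abs_weight_le hε hs0)
  have hA : Integrable (fun x => weight ε s (x k) * (1 / M * (∑ i : {i // i ≠ k}, ‖g i x‖ ^ 2) +
      totalPotential Z V W x * ‖Φ x‖ ^ 2) + 3 * Z * ‖Φ x‖ ^ 2) volume :=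
    (hbdd hG).add (hΦ2.const_mul _)
  have hB : Integrable (fun x => weight ε s (x k) * (interactionWith W k x * ‖Φ x‖ ^ 2) +
      E' * (weight ε s (x k) * ‖Φ x‖ ^ 2)) volume :=
    (hbdd hR).add ((hbdd hΦ2).const_mul _)
  have hmono : 0 ≤ ∫ x, ((weight ε s (x k) * (1 / M * (∑ i : {i // i ≠ k}, ‖g i x‖ ^ 2) +
      totalPotential Z V W x * ‖Φ x‖ ^ 2) + 3 * Z * ‖Φ x‖ ^ 2) -
      (weight ε s (x k) * (interactionWith W k x * ‖Φ x‖ ^ 2) +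
      E' * (weight ε s (x k) * ‖Φ x‖ ^ 2))) := by
    -- Pointwise, the weighted attraction is replaced by its bound `3Z`.
    refine hslice.trans (integral_mono ?_ (hA.sub hB) fun x => ?_)
    · exact hbdd (((hG.add hV).sub hR).sub (hΦ2.const_mul _))
    · have h1 := mul_weight_le_three hε hs0 (h.attraction_le k (x k))
      have h2 := mul_le_mul_of_nonneg_right (mul_le_mul_of_nonneg_left h1 hZ.le)
        (sq_nonneg ‖Φ x‖)
      simp only
      linarith
  rw [integral_sub hA hB, integral_add (hbdd hG) (hΦ2.const_mul _),
    integral_add (hbdd hR) ((hbdd hΦ2).const_mul _), integral_const_mul, integral_const_mul,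
    hnorm] at hmono
  have h1 := weighted_energy_le hs hM k hE hΦ hint hnorm hε ht htε hle
  have h2 := h.integral_inv_sqrt_le hs hZ hM hE' hΦ hint hnorm (hle.trans htE) hL
  have h3 : 1 / (4 * M) * (∫ x : ι → ℝ, 1 / √(x k ^ 2 + 1) * ‖Φ x‖ ^ 2) ≤
      3 * Z * Real.log L ^ 2 + 1 / (2 * L * M) := by
    calc _ ≤ 1 / (4 * M) * (12 * Z * M * Real.log L ^ 2 + 2 / L) := by gcongr
      _ = _ := by
        field_simp
        ring
  have h4 : t / M ≤ 1 / 2 := by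
    rw [div_le_iff₀ hM]
    linarith
  linarith

end Variation

/-! ### Symmetrized sums over pairs -/

section PairSums

variable {ι : Type*} [Fintype ι]

theorem sum_sum_mul_add_eq (p : ι → ι → ℝ) (w : ι → ℝ) :
    ∑ k, ∑ j, p k j * (w k + w j) = ∑ k, w k * ∑ j, (p k j + p j k) := by
  have h1 : ∑ k, ∑ j, p k j * w j = ∑ k, ∑ j, p j k * w k := Finset.sum_comm
  simp only [mul_add, Finset.sum_add_distrib, h1, Finset.mul_sum]
  simp only [mul_comm]

variable [LinearOrder ι]

theorem sum_ite_lt_add_ite_lt (k : ι) :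
    ∑ j, ((if k < j then (1 : ℝ) else 0) + (if j < k then 1 else 0)) = Fintype.card ι - 1 := by
  have h1 : ∀ j, (if k < j then (1 : ℝ) else 0) + (if j < k then 1 else 0) =
      1 - if j = k then 1 else 0 := fun j => by
    rcases lt_trichotomy j k with h | h | h
    · simp [h, h.not_gt, h.ne]
    · simp [h]
    · simp [h, h.not_gt, h.ne']
  simp only [h1, Finset.sum_sub_distrib]
  simp

/-- Each index lies in `n - 1` pairs, so the error is `ε (n - 1) ∑ w`, enlarged to `ε n ∑ w`. -/
theorem sum_pairs_lower_bound (ε : ℝ) (hε : 0 ≤ ε) (w : ι → ℝ) (hw : ∀ k, 0 ≤ w k) :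
    (Fintype.card ι : ℝ) * (Fintype.card ι - 1) / 2 - ε * Fintype.card ι * ∑ k, w k ≤
      ∑ k, ∑ j, (if k < j then (1 : ℝ) else 0) * (1 - ε * w k - ε * w j) := by
  have h1 := sum_sum_mul_add_eq (fun k j : ι => if k < j then (1 : ℝ) else 0) (fun _ => 1 / 2)
  have h2 := sum_sum_mul_add_eq (fun k j : ι => if k < j then (1 : ℝ) else 0) w
  simp only [sum_ite_lt_add_ite_lt] at h1 h2
  simp only [Finset.sum_const, Finset.card_univ, nsmul_eq_mul, ← Finset.sum_mul] at h1 h2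
  have h3 : ∑ k, ∑ j, (if k < j then (1 : ℝ) else 0) * (1 - ε * w k - ε * w j) =
      (∑ k : ι, ∑ j, (if k < j then (1 : ℝ) else 0)) -
        ε * ∑ k, ∑ j, (if k < j then (1 : ℝ) else 0) * (w k + w j) := by
    simp only [Finset.mul_sum, ← Finset.sum_sub_distrib]
    refine Finset.sum_congr rfl fun k _ => Finset.sum_congr rfl fun j _ => ?_
    ring
  rw [h3, h2]
  have h4 : 0 ≤ ε * ∑ k, w k := mul_nonneg hε (Finset.sum_nonneg fun k _ => hw k)
  nlinarith

end PairSums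

/-! ### The bound on the number of particles -/

section MaximalIonization

variable {ι : Type*} [Fintype ι] [LinearOrder ι]

/-- The diagonal is a proper subspace, hence null; this removes the points where the repulsion bound
is not available. -/
theorem ae_coord_ne {i j : ι} (hij : i ≠ j) : ∀ᵐ x : ι → ℝ, x i ≠ x j := by
  set p : Submodule ℝ (ι → ℝ) :=
    LinearMap.ker ((LinearMap.proj i : (ι → ℝ) →ₗ[ℝ] ℝ) - LinearMap.proj j) with hp
  have hne : p ≠ ⊤ := fun htop => by
    have h1 : (Pi.single i 1 : ι → ℝ) ∈ p := htop ▸ Submodule.mem_top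
    simp [hp, hij] at h1
  have h0 := Measure.addHaar_submodule (volume : Measure (ι → ℝ)) p hne
  rw [ae_iff]
  convert h0 using 2
  ext x
  simp [hp, sub_eq_zero]

variable {s Z M : ℝ} {V : ι → ℝ → ℝ} {W : ι → ι → ℝ → ℝ}

theorem CoulombBounds.sum_weighted_interaction_ge (h : CoulombBounds s V W) (hs : 0 < s) {ε : ℝ}
    (hε : 0 < ε) {x : ι → ℝ} (hx : ∀ i j, i ≠ j → x i ≠ x j) :
    (Fintype.card ι : ℝ) * (Fintype.card ι - 1) / 2
      - ε * Fintype.card ι * ∑ k, weight ε s (x k) ≤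
      ∑ k, weight ε s (x k) * interactionWith W k x := by
  refine (sum_pairs_lower_bound ε hε.le _ fun k => (weight_pos hε hs (x k)).le).trans ?_
  simp only [interactionWith]
  rw [← sum_sum_mul_add_eq (fun k j => pairPotential W k j x) (fun k => weight ε s (x k))]
  refine Finset.sum_le_sum fun k _ => Finset.sum_le_sum fun j _ => ?_
  unfold pairPotential
  split_ifs with hkj
  · rw [one_mul]
    exact one_sub_weight_le hε hs (h.le_repulsion k j hkj _ (sub_ne_zero.2 (hx k j hkj.ne)))
  · simp

/-- The maximal number of electrons of a one-dimensional atom with a nucleus of charge `Z`. -/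
theorem CoulombBounds.card_le_of_hasBoundState (h : CoulombBounds s V W) (hs : 1 ≤ s) (hZ : 0 < Z)
    (hM : 0 < M) (hb : HasBoundState Z M V W) {L : ℝ} (hL : 1 ≤ L) :
    (Fintype.card ι : ℝ) ≤ 3 + 2 * (3 * Z + 3 * Z * Real.log L ^ 2 + 1 / (2 * L * M)) := by
  have hs0 : 0 < s := by linarith
  have hL0 : 0 < L := by linarith
  set D := 3 * Z + 3 * Z * Real.log L ^ 2 + 1 / (2 * L * M) with hD
  have hD0 : 0 ≤ D := by positivity
  set n := (Fintype.card ι : ℝ) with hn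
  have hn0 : 0 ≤ n := Nat.cast_nonneg _
  obtain ⟨E', hEE', hE'⟩ := EReal.lt_iff_exists_real_btwn.1 hb
  have hbelow : ((-(3 * Z * n) : ℝ) : EReal) ≤ groundEnergy Z M V W := by
    refine le_iInf₂ fun e he => ?_
    obtain ⟨Φ, g, hΦ, hint, hnorm, rfl⟩ := he
    rw [EReal.coe_le_coe_iff]
    have hΦ2 : Integrable (fun x => ‖Φ x‖ ^ 2) volume :=
      hΦ.1.integrable_norm_pow (p := 2) (by norm_num)
    have h1 : ∫ x, -(3 * Z * n) * ‖Φ x‖ ^ 2 ≤ ∫ x, totalPotential Z V W x * ‖Φ x‖ ^ 2 :=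
      integral_mono (hΦ2.const_mul _) hint fun x =>
        mul_le_mul_of_nonneg_right (h.neg_le_totalPotential hs hZ x) (sq_nonneg _)
    rw [integral_const_mul, hnorm, mul_one] at h1
    have h2 : 0 ≤ 1 / M * (∑ i, ∫ x, ‖g i x‖ ^ 2) :=
      mul_nonneg (by positivity) (Finset.sum_nonneg fun i _ =>
        integral_nonneg fun x => by positivity)
    linarith
  obtain ⟨E, hE⟩ : ∃ E : ℝ, (E : EReal) = groundEnergy Z M V W :=
    ⟨_, EReal.coe_toReal (hEE'.trans_le le_top).ne
      ((EReal.bot_lt_coe _).trans_le hbelow).ne'⟩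
  have hgap : 0 < E' - E := by
    rw [← hE, EReal.coe_lt_coe_iff] at hEE'
    linarith
  -- Chosen so that the cutoff error `ε n ∑ w` is at most the gap term `(E' - E) ∑ w`; the `+ 1`
  -- covers `n = 0`.
  set ε := (E' - E) / (n + 1) with hεd
  have hε : 0 < ε := by positivity
  have hεn : ε * n ≤ E' - E := by
    rw [hεd, div_mul_eq_mul_div, div_le_iff₀ (by positivity)]
    nlinarith
  -- The three bounds keep `1 - t w ≥ 1/2`, make `t / M ≤ 1/2`, and keep the trial energy `E + t /
  -- 2` below `E'`.
  set t := min (min (ε / 2) (M / 2)) (E' - E) with htd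
  have ht : 0 < t := by positivity
  have ht1 : t ≤ ε / 2 := (min_le_left _ _).trans (min_le_left _ _)
  have ht2 : t ≤ M / 2 := (min_le_left _ _).trans (min_le_right _ _)
  have ht3 : t ≤ E' - E := min_le_right _ _
  obtain ⟨e, he, heE⟩ : ∃ e ∈ energyValues Z M V W, (e : EReal) < ((E + t / 2 : ℝ) : EReal) := by
    have h1 : groundEnergy Z M V W < ((E + t / 2 : ℝ) : EReal) := by
      rw [← hE, EReal.coe_lt_coe_iff]
      linarith
    unfold groundEnergy at h1
    simpa only [iInf_lt_iff, exists_prop] using h1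
  obtain ⟨Φ, g, hΦ, hint, hnorm, rfl⟩ := he
  rw [EReal.coe_lt_coe_iff] at heE
  have hΦ2 : Integrable (fun x => ‖Φ x‖ ^ 2) volume :=
    hΦ.1.integrable_norm_pow (p := 2) (by norm_num)
  have hbdd : ∀ {u : (ι → ℝ) → ℝ} (k : ι), Integrable u volume →
      Integrable (fun x => weight ε s (x k) * u x) volume := fun k hu =>
    hu.bdd_mul ((contDiff_weight hε hs0).continuous.comp
      (continuous_apply k)).aestronglyMeasurable
      (Eventually.of_forall fun x => abs_weight_le hε hs0 _)
  have hk : ∀ k, (E' - E) * (∫ x, weight ε s (x k) * ‖Φ x‖ ^ 2) +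
      (∫ x, weight ε s (x k) * (interactionWith W k x * ‖Φ x‖ ^ 2)) ≤ D + 1 := fun k =>
    h.weighted_repulsion_le hs hZ hM k hE.le (hE'.le.trans (iInf_le _ k)) hΦ hint hnorm hε ht
      (by linarith) (by linarith) (by linarith) heE.le hL
  have hsum := Finset.sum_le_sum fun k (_ : k ∈ Finset.univ) => hk k
  rw [Finset.sum_add_distrib, ← Finset.mul_sum, Finset.sum_const, Finset.card_univ,
    nsmul_eq_mul] at hsum
  have hwi : ∀ k ∈ Finset.univ, Integrable (fun x => weight ε s (x k) * ‖Φ x‖ ^ 2) volume :=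
    fun k _ => hbdd k hΦ2
  have hRi : ∀ k ∈ Finset.univ, Integrable
      (fun x => weight ε s (x k) * (interactionWith W k x * ‖Φ x‖ ^ 2)) volume := fun k _ =>
    hbdd k (h.integrable_interactionWith hs hZ hΦ.1 hint k)
  have hrep : ∫ x, (n * (n - 1) / 2 * ‖Φ x‖ ^ 2
      - ε * n * ∑ k, weight ε s (x k) * ‖Φ x‖ ^ 2) ≤
      ∫ x, ∑ k, weight ε s (x k) * (interactionWith W k x * ‖Φ x‖ ^ 2) := by
    refine integral_mono_ae ((hΦ2.const_mul _).sub ((integrable_finsetSum _ hwi).const_mul _))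
      (integrable_finsetSum _ hRi) ?_
    have hae : ∀ᵐ x : ι → ℝ, ∀ i j, i ≠ j → x i ≠ x j := by
      refine eventually_all.2 fun i => eventually_all.2 fun j => ?_
      by_cases hij : i = j
      · exact Eventually.of_forall fun x hne => absurd hij hne
      · filter_upwards [ae_coord_ne hij] with x hx _ using hx
    filter_upwards [hae] with x hx
    have h1 := mul_le_mul_of_nonneg_right (h.sum_weighted_interaction_ge hs0 hε hx)
      (sq_nonneg ‖Φ x‖)
    simp only [← mul_assoc, ← Finset.sum_mul]
    rw [← hn] at h1
    linarith
  rw [integral_sub (hΦ2.const_mul _) ((integrable_finsetSum _ hwi).const_mul _),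
    integral_const_mul, integral_const_mul, hnorm, integral_finsetSum _ hwi,
    integral_finsetSum _ hRi] at hrep
  have hw0 : 0 ≤ ∑ k, ∫ x, weight ε s (x k) * ‖Φ x‖ ^ 2 :=
    Finset.sum_nonneg fun k _ => integral_nonneg fun x =>
      mul_nonneg (weight_pos hε hs0 _).le (sq_nonneg _)
  have habs := mul_le_mul_of_nonneg_right hεn hw0
  -- The sum of the one-particle inequalities meets the pair bound; the terms in `∑ w` drop out by
  -- the choice of `ε`.
  have hfin : n * (n - 1) / 2 ≤ n * (D + 1) := by linarith
  rcases hn0.eq_or_lt with h0 | h0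
  · rw [← h0]
    positivity
  · have h1 : n * ((n - 1) / 2) ≤ n * (D + 1) := by linarith
    have h2 := le_of_mul_le_mul_left h1 h0
    linarith

end MaximalIonization

end StrongField

/-! ### Choice of the cutoff length and of the constant -/

theorem corollary3 (a p Z₀ : ℝ) (ha : 0 < a) (hp : 3 < p) (hZ₀ : 1 < Z₀) :
    ∃ A : ℝ, 0 < A ∧ ∀ Z B : ℝ, Z₀ ≤ Z → B = a * Z ^ p →
      (∀ (N μ ν : ℕ) (V : Fin N → ℝ → ℝ) (W : Fin N → Fin N → ℝ → ℝ),
        ν ≤ 2 * μ → StrongField.PotentialBounds μ ν V W →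
        3 * Z + A * Z * Real.log Z ^ 2 < (N : ℝ) →
        ¬ StrongField.HasBoundState Z (B ^ (-(1 / 2) : ℝ)) V W) ∧
      (∀ (μ ν : ℕ → ℕ) (V : (N : ℕ) → Fin N → ℝ → ℝ)
        (W : (N : ℕ) → Fin N → Fin N → ℝ → ℝ),
        (∀ N, ν N ≤ 2 * μ N ∧ StrongField.PotentialBounds (μ N) (ν N) (V N) (W N)) →
        ∃ n : ℕ, StrongField.maxElectrons Z (B ^ (-(1 / 2) : ℝ)) V W = (n : ℕ∞) ∧
          (n : ℝ) ≤ 3 * Z + A * Z * Real.log Z ^ 2) := by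
  have hl : 0 < Real.log Z₀ := Real.log_pos hZ₀
  -- The summand `3p²/2` matches `6 (log L)² = 6 (p/2)² (log Z)²`. The other one dominates the
  -- excess `3 + 3Z + √a`, using `Z ≥ 1` and `log Z ≥ log Z₀`.
  refine ⟨(9 + √a) / Real.log Z₀ ^ 2 + 3 * p ^ 2 / 2, by positivity, fun Z B hZ hB => ?_⟩
  set A := (9 + √a) / Real.log Z₀ ^ 2 + 3 * p ^ 2 / 2 with hA
  have hZ1 : 1 < Z := hZ₀.trans_le hZ
  have hZ0 : 0 < Z := by linarith
  have hB0 : 0 < B := by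
    rw [hB]
    positivity
  set M := B ^ (-(1 / 2) : ℝ) with hM
  have hM0 : 0 < M := Real.rpow_pos_of_pos hB0 _
  -- As `M = B^(-1/2) = 1/(√a L)`, the error `1/(2LM)` is the constant `√a / 2`, while `log L` is a
  -- multiple of `log Z`.
  set L := Z ^ (p / 2) with hLd
  have hL : 1 ≤ L := Real.one_le_rpow hZ1.le (by linarith)
  have hL0 : 0 < L := by linarith
  have hlogL : Real.log L = p / 2 * Real.log Z := Real.log_rpow hZ0 _
  have hLM : 1 / (2 * L * M) = √a / 2 := by
    have h1 : M = (√a * L)⁻¹ := by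
      rw [hM, Real.rpow_neg hB0.le, hB, Real.mul_rpow ha.le (by positivity), ← Real.sqrt_eq_rpow,
        ← Real.rpow_mul hZ0.le, hLd]
      congr 3
      ring
    have h2 : 0 < √a := Real.sqrt_pos.2 ha
    rw [h1]
    field_simp
  have hbound : 3 + 2 * (3 * Z + 3 * Z * Real.log L ^ 2 + 1 / (2 * L * M)) ≤
      3 * Z + A * Z * Real.log Z ^ 2 := by
    have hlog : Real.log Z₀ ^ 2 ≤ Real.log Z ^ 2 := by
      gcongr
    have h1 : 9 + √a ≤ (9 + √a) / Real.log Z₀ ^ 2 * Real.log Z ^ 2 := by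
      rw [div_mul_eq_mul_div, le_div_iff₀ (by positivity)]
      gcongr
    have h2 := mul_le_mul_of_nonneg_right h1 hZ0.le
    have h3 : √a ≤ √a * Z := le_mul_of_one_le_right (Real.sqrt_nonneg a) hZ1.le
    rw [hlogL, hLM, hA]
    nlinarith
  have main : ∀ (N μ ν : ℕ) (V : Fin N → ℝ → ℝ) (W : Fin N → Fin N → ℝ → ℝ), ν ≤ 2 * μ →
      StrongField.PotentialBounds μ ν V W → StrongField.HasBoundState Z M V W →
      (N : ℝ) ≤ 3 * Z + A * Z * Real.log Z ^ 2 := fun N μ ν V W hν hP hb => by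
    have h1 := (hP.coulombBounds hν).card_le_of_hasBoundState (by simp) hZ0 hM0 hb hL
    rw [Fintype.card_fin] at h1
    exact h1.trans hbound
  refine ⟨fun N μ ν V W hν hP hN hb => (main N μ ν V W hν hP hb).not_gt hN,
    fun μ ν V W hP => ?_⟩
  have hC0 : 0 ≤ 3 * Z + A * Z * Real.log Z ^ 2 := by positivity
  have hle : StrongField.maxElectrons Z M V W ≤ (⌊3 * Z + A * Z * Real.log Z ^ 2⌋₊ : ℕ∞) :=
    iSup₂_le fun N hN => by
      exact_mod_cast Nat.le_floor (main N (μ N) (ν N) (V N) (W N) (hP N).1 (hP N).2 hN)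
  obtain ⟨n, hn⟩ := ENat.ne_top_iff_exists.1 (ne_top_of_le_ne_top (ENat.natCast_ne_top _) hle)
  refine ⟨n, hn.symm, ?_⟩
  rw [← hn] at hle
  exact (Nat.cast_le.2 (by exact_mod_cast hle : n ≤ ⌊_⌋₊)).trans (Nat.floor_le hC0)
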